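/- Let $f_1,\dots,f_n:\mathbb R^p\to\mathbb R$ ($n\ge 1$) be continuously differentiable with $\|\nabla f_i(x)-\nabla f_i(u)\|_2\le L\|x-u\|_2$ and $\langle\nabla f_i(x)-\nabla f_i(u),x-u\rangle\ge\mu\|x-u\|_2^2$ for all $i,x,u$, where $L,\mu>0$; put $f=\sum_i f_i$, $\hat L=nL$, $\hat\mu=n\mu$. Let $\mathbb G$ be a strongly connected directed graph on $\{1,\dots,n\}$, with in- and out-neighbourhoods $\mathcal N_i^{\rm in},\mathcal N_i^{\rm out}$. For $k\ge1$ let $A_k,B_k\in\mathbb R^{n\times n}$ satisfy $A_k\mathbf 1=\mathbf 1$, $\mathbf 1^TB_k=\mathbf 1^T$, and, for constants $a,b>0$ independent of $k$: $[A_k]_{ij}\ge a$ if $j\in\mathcal N_i^{\rm in}\cup\{i\}$ and $[A_k]_{ij}=0$ otherwise; $[B_k]_{li}\ge b$ if $l\in\mathcal N_i^{\rm out}\cup\{i\}$ and $[B_k]_{li}=0$ otherwise. Let $\lambda_k>0$ ($k\ge1$) be nonincreasing with $\lambda_k\to0$ and $\sum_{k\ge1}\lambda_k=\infty$. With step sizes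 $\alpha_i\ge0$ and arbitrary $x_i^1\in\mathbb R^p$, $y_i^1=\lambda_1\nabla f_i(x_i^1)$, consider for $k\ge1$ $$x_i^{k+1}=\sum_{j}[A_k]_{ij}(x_j^k-\alpha_jy_j^k),\qquad y_i^{k+1}=\sum_{j}[B_k]_{ij}y_j^k+\lambda_{k+1}\nabla f_i(x_i^{k+1})-\lambda_k\nabla f_i(x_i^k).$$ Let $\pi_1=\frac1n\mathbf 1$ and $\pi_{k+1}=B_k\pi_k$. There are stochastic vectors $\phi_k$ ($k\ge1$) with $\phi_{k+1}^TA_k=\phi_k^T$, norms $\|\cdot\|_A,\|\cdot\|_B$ on $\mathbb R^n$ (the same symbols denote the induced matrix norms) and constants $\delta_{A,B},\delta_{B,2}>0$ such that $$\sigma_{A,k}:=\|A_k-\mathbf 1\phi_k^T\|_A<1,\quad \sigma_{B,k}:=\|B_k-\pi_k\mathbf 1^T\|_B<1\quad(k\ge1),$$ $$\|\cdot\|_2\le\|\cdot\|_A\le\delta_{A,B}\|\cdot\|_B,\qquad \|\cdot\|_2\le\|\cdot\|_B\le\delta_{B,2}\|\cdot\|_2 .$$ For any such choice let $\check\alpha=\max_i\alpha_i$,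 $\theta_k=\phi_k^T\mathrm{diag}(\alpha_1,\dots,\alpha_n)\pi_k/\check\alpha$, $\xi_{k}=\|I-\pi_{k}\mathbf 1^T\|_B$, and $$\begin{aligned} e_{1,k}={}&n\sqrt n L^2\sigma_{A,k}\delta_{B,2}\xi_{k+1}\|A_k\|_2\|\pi_k\|_2\lambda_k^2\lambda_{k+1}\big(L\delta_{A,B}\theta_k+L\|\phi_k\|_2\|\pi_k\|_A+\mu\delta_{A,B}\theta_k\big),\\ e_{2,k}={}&nL\sigma_{A,k}\delta_{B,2}\xi_{k+1}\lambda_k(\lambda_k-\lambda_{k+1})\big((L+\mu)\delta_{A,B}\theta_k+L\|\phi_k\|_2\|\pi_k\|_A\big)\\ &+nL\delta_{B,2}\xi_{k+1}\lambda_k\lambda_{k+1}\Big(\tfrac12L\|\phi_k\|_2(1-\sigma_{A,k})\|A_k\|_2\|\pi_k\|_2\\ &\qquad+(L\sigma_{A,k}\|\phi_k\|_2\|\pi_k\|_A+\mu\delta_{A,B}\sigma_{A,k}\theta_k)(\|A_k\|_2+1)\Big)\\ &+\tfrac12n\sqrt nL^2\sigma_{A,k}\|\pi_k\|_A(1-\sigma_{B,k})\theta_k\lambda_k^2,\\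 e_{3,k}={}&\tfrac14\hat\mu(1-\sigma_{A,k})(1-\sigma_{B,k})\theta_k\lambda_k-\tfrac12\sqrt nL\delta_{B,2}\xi_{k+1}\|\phi_k\|_2(1-\sigma_{A,k})(\lambda_k-\lambda_{k+1}). \end{aligned}$$ Then $f$ has a unique minimizer $x^*$. Moreover, if $\check\alpha>0$ and for some $k_0\ge1$ one has, for every $k\ge k_0$, $e_{3,k}>0$ and $$\check\alpha<\min\Big\{\frac{2}{\theta_k\lambda_k(\hat\mu+\hat L)},\ \frac{1-\sigma_{A,k}}{2\sqrt nL\sigma_{A,k}\lambda_k\|\pi_k\|_A},\ \frac{1-\sigma_{B,k}}{2L\delta_{B,2}\xi_{k+1}\lambda_{k+1}\|A_k\|_2},\ \frac{2e_{3,k}}{e_{2,k}+\sqrt{e_{2,k}^2+4e_{1,k}e_{3,k}}}\Big\}$$ (a quotient with denominator $0$ is read as $+\infty$), then $x_i^k\to x^*$ as $k\to\infty$ for every agent $i$. -/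

import Mathlib

noncomputable section

namespace WeightedGT

open Matrix

/-- Decision vectors in `ℝ^p` with the Euclidean norm. -/
abbrev Vec (p : ℕ) : Type := EuclideanSpace ℝ (Fin p)

/-- Every `f i` is continuously differentiable with `L`-Lipschitz gradient. -/
def SmoothObjectives {n p : ℕ} (f : Fin n → Vec p → ℝ) (L : ℝ) : Prop :=
  ∀ i, ContDiff ℝ 1 (f i) ∧
    ∀ x u : Vec p, ‖gradient (f i) x - gradient (f i) u‖ ≤ L * ‖x - u‖

/-- Every `f i` is `μ`-strongly convex, in the form of strong monotonicity of its gradient. -/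
def StronglyConvexObjectives {n p : ℕ} (f : Fin n → Vec p → ℝ) (μ : ℝ) : Prop :=
  ∀ i, ∀ x u : Vec p,
    μ * ‖x - u‖ ^ 2 ≤ inner ℝ (gradient (f i) x - gradient (f i) u) (x - u)

/-- There is a directed path between any two agents. `G.Adj j i` is the edge from `j` to `i`. -/
def StronglyConnected {n : ℕ} (G : Digraph (Fin n)) : Prop :=
  ∀ i j, Relation.ReflTransGen G.Adj i j

/-- The matrices `A k`, `k ≥ 1`, are row-stochastic and compatible with `G`: the entry `(i, j)` is
at least some fixed `a > 0` if `j` is an in-neighbour of `i` or `j = i`, and zero otherwise. -/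
def RowStochasticCompatible {n : ℕ} (G : Digraph (Fin n))
    (A : ℕ → Matrix (Fin n) (Fin n) ℝ) : Prop :=
  ∃ a : ℝ, 0 < a ∧ ∀ k, 1 ≤ k →
    (∀ i j, (G.Adj j i ∨ j = i) → a ≤ A k i j) ∧
    (∀ i j, ¬ (G.Adj j i ∨ j = i) → A k i j = 0) ∧
    (∀ i, ∑ j, A k i j = 1)

/-- The matrices `B k`, `k ≥ 1`, are column-stochastic and compatible with `G`: the entry `(l, i)`
is at least some fixed `b > 0` if `l` is an out-neighbour of `i` or `l = i`, and zero otherwise. -/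
def ColStochasticCompatible {n : ℕ} (G : Digraph (Fin n))
    (B : ℕ → Matrix (Fin n) (Fin n) ℝ) : Prop :=
  ∃ b : ℝ, 0 < b ∧ ∀ k, 1 ≤ k →
    (∀ l i, (G.Adj i l ∨ l = i) → b ≤ B k l i) ∧
    (∀ l i, ¬ (G.Adj i l ∨ l = i) → B k l i = 0) ∧
    (∀ i, ∑ l, B k l i = 1)

/-- The decaying weights: positive, nonincreasing, tending to `0`, with `∑_{k ≥ 1} lam k = ∞`.
Only the values at `k ≥ 1` matter. -/
structure DecayingWeights (lam : ℕ → ℝ) : Prop where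
  pos : ∀ k, 1 ≤ k → 0 < lam k
  nonincreasing : ∀ k, 1 ≤ k → lam (k + 1) ≤ lam k
  tendsto_zero : Filter.Tendsto lam Filter.atTop (nhds 0)
  sum_eq_top : Filter.Tendsto (fun K => ∑ k ∈ Finset.Icc 1 K, lam k) Filter.atTop Filter.atTop

/-- `(x k i, y k i)`, `k ≥ 1`, are iterates of the weighted gradient-tracking algorithm, with
arbitrary initial states `x 1 i`. The entries of the weight matrices vanish outside the closed
in-neighbourhoods, so the sums run over all agents. -/
structure IsTrajectory {n p : ℕ} (f : Fin n → Vec p → ℝ)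
    (A B : ℕ → Matrix (Fin n) (Fin n) ℝ) (α : Fin n → ℝ) (lam : ℕ → ℝ)
    (x y : ℕ → Fin n → Vec p) : Prop where
  y_init : ∀ i, y 1 i = lam 1 • gradient (f i) (x 1 i)
  x_step : ∀ k, 1 ≤ k → ∀ i, x (k + 1) i = ∑ j, A k i j • (x k j - α j • y k j)
  y_step : ∀ k, 1 ≤ k → ∀ i,
    y (k + 1) i = ∑ j, B k i j • y k j
      + lam (k + 1) • gradient (f i) (x (k + 1) i) - lam k • gradient (f i) (x k i)

/-- `π_1 = (1/n) 𝟏` and `π_{k+1} = B_k π_k` for `k ≥ 1` (the value at `0` is not used). -/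
def piSeq {n : ℕ} (B : ℕ → Matrix (Fin n) (Fin n) ℝ) : ℕ → Fin n → ℝ
  | 0 => fun _ => 1 / (n : ℝ)
  | 1 => fun _ => 1 / (n : ℝ)
  | (k + 2) => B (k + 1) *ᵥ piSeq B (k + 1)

/-- Stochastic vectors `φ_k`, `k ≥ 1`, with `φ_{k+1}ᵀ A_k = φ_kᵀ`. -/
structure IsAbsoluteProbabilitySequence {n : ℕ} (A : ℕ → Matrix (Fin n) (Fin n) ℝ)
    (φ : ℕ → Fin n → ℝ) : Prop where
  nonneg : ∀ k, 1 ≤ k → ∀ i, 0 ≤ φ k i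
  sum_eq_one : ∀ k, 1 ≤ k → ∑ i, φ k i = 1
  step : ∀ k, 1 ≤ k → φ (k + 1) ᵥ* A k = φ k

/-- Euclidean norm on `ℝ^n`. -/
def norm2 {n : ℕ} (v : Fin n → ℝ) : ℝ := Real.sqrt (∑ i, v i ^ 2)

/-- Matrix norm induced by a vector norm `N`. -/
def inducedNorm {n : ℕ} (N : (Fin n → ℝ) → ℝ) (M : Matrix (Fin n) (Fin n) ℝ) : ℝ :=
  sInf {c : ℝ | 0 ≤ c ∧ ∀ v, N (M *ᵥ v) ≤ c * N v}

/-- `σ_{A,k} = ‖A_k - 𝟏 φ_kᵀ‖_A`. -/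
def sigmaA {n : ℕ} (NA : Seminorm ℝ (Fin n → ℝ)) (A : ℕ → Matrix (Fin n) (Fin n) ℝ)
    (φ : ℕ → Fin n → ℝ) (k : ℕ) : ℝ :=
  inducedNorm NA (A k - vecMulVec (fun _ => 1) (φ k))

/-- `σ_{B,k} = ‖B_k - π_k 𝟏ᵀ‖_B`. -/
def sigmaB {n : ℕ} (NB : Seminorm ℝ (Fin n → ℝ)) (B : ℕ → Matrix (Fin n) (Fin n) ℝ)
    (k : ℕ) : ℝ :=
  inducedNorm NB (B k - vecMulVec (piSeq B k) (fun _ => 1))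

/-- `ξ_k = ‖I - π_k 𝟏ᵀ‖_B`. -/
def xi {n : ℕ} (NB : Seminorm ℝ (Fin n → ℝ)) (B : ℕ → Matrix (Fin n) (Fin n) ℝ)
    (k : ℕ) : ℝ :=
  inducedNorm NB (1 - vecMulVec (piSeq B k) (fun _ => 1))

/-- Two norms `‖·‖_A`, `‖·‖_B` on `ℝ^n` and constants `δ_{A,B}`, `δ_{B,2}` in terms of which the
step-size bound is written: `σ_{A,k} < 1` and `σ_{B,k} < 1` for all `k ≥ 1`, both norms dominate
the Euclidean norm (hence are definite), `‖·‖_A ≤ δ_{A,B} ‖·‖_B` and `‖·‖_B ≤ δ_{B,2} ‖·‖_2`. -/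
structure AdmissibleNorms {n : ℕ} (A B : ℕ → Matrix (Fin n) (Fin n) ℝ) (φ : ℕ → Fin n → ℝ)
    (NA NB : Seminorm ℝ (Fin n → ℝ)) (δAB δB2 : ℝ) : Prop where
  norm2_le_A : ∀ v, norm2 v ≤ NA v
  norm2_le_B : ∀ v, norm2 v ≤ NB v
  sigmaA_lt_one : ∀ k, 1 ≤ k → sigmaA NA A φ k < 1
  sigmaB_lt_one : ∀ k, 1 ≤ k → sigmaB NB B k < 1
  δAB_pos : 0 < δAB
  δB2_pos : 0 < δB2
  A_le_B : ∀ v, NA v ≤ δAB * NB v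
  B_le_norm2 : ∀ v, NB v ≤ δB2 * norm2 v

/-- `α̌ = max_i α_i`. -/
def alphaMax {n : ℕ} (α : Fin n → ℝ) : ℝ := ⨆ i, α i

/-- `θ_k = φ_kᵀ diag(α) π_k / α̌`. -/
def theta {n : ℕ} (B : ℕ → Matrix (Fin n) (Fin n) ℝ) (φ : ℕ → Fin n → ℝ) (α : Fin n → ℝ)
    (k : ℕ) : ℝ :=
  (∑ i, φ k i * α i * piSeq B k i) / alphaMax α

section Coefficients

variable {n : ℕ} (L μ : ℝ) (A B : ℕ → Matrix (Fin n) (Fin n) ℝ) (lam : ℕ → ℝ)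
  (α : Fin n → ℝ) (φ : ℕ → Fin n → ℝ) (NA NB : Seminorm ℝ (Fin n → ℝ)) (δAB δB2 : ℝ) (k : ℕ)

/-- The coefficient `e_{1,k}`. -/
def e1 : ℝ :=
  n * Real.sqrt n * L ^ 2 * sigmaA NA A φ k * δB2 * xi NB B (k + 1)
    * inducedNorm norm2 (A k) * norm2 (piSeq B k) * lam k ^ 2 * lam (k + 1)
    * (L * δAB * theta B φ α k + L * norm2 (φ k) * NA (piSeq B k) + μ * δAB * theta B φ α k)

/-- The coefficient `e_{2,k}`. -/
def e2 : ℝ :=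
  n * L * sigmaA NA A φ k * δB2 * xi NB B (k + 1) * lam k * (lam k - lam (k + 1))
      * ((L + μ) * δAB * theta B φ α k + L * norm2 (φ k) * NA (piSeq B k))
    + n * L * δB2 * xi NB B (k + 1) * lam k * lam (k + 1)
      * (1 / 2 * L * norm2 (φ k) * (1 - sigmaA NA A φ k) * inducedNorm norm2 (A k)
            * norm2 (piSeq B k)
          + (L * sigmaA NA A φ k * norm2 (φ k) * NA (piSeq B k)
              + μ * δAB * sigmaA NA A φ k * theta B φ α k) * (inducedNorm norm2 (A k) + 1))
    + 1 / 2 * n * Real.sqrt n * L ^ 2 * sigmaA NA A φ k * NA (piSeq B k)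
      * (1 - sigmaB NB B k) * theta B φ α k * lam k ^ 2

/-- The coefficient `e_{3,k}`, where `μ̂ = n μ`. -/
def e3 : ℝ :=
  1 / 4 * (n * μ) * (1 - sigmaA NA A φ k) * (1 - sigmaB NB B k) * theta B φ α k * lam k
    - 1 / 2 * Real.sqrt n * L * δB2 * xi NB B (k + 1) * norm2 (φ k) * (1 - sigmaA NA A φ k)
      * (lam k - lam (k + 1))

/-- The step-size bound from index `k₀` on: `0 < α̌` and, for all `k ≥ k₀`, `α̌` is less than
`2 / (θ_k λ_k (μ̂ + L̂))`, `(1 - σ_{A,k}) / (2 √n L σ_{A,k} λ_k ‖π_k‖_A)`,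
`(1 - σ_{B,k}) / (2 L δ_{B,2} ξ_{k+1} λ_{k+1} ‖A_k‖_2)` and
`2 e_{3,k} / (e_{2,k} + √(e_{2,k}² + 4 e_{1,k} e_{3,k}))`, where `μ̂ = n μ` and `L̂ = n L`.
The nonnegative denominators are multiplied out, so that a bound with denominator `0` and positive
numerator reads as `+∞`. The last clause forces `e_{3,k} > 0`. -/
def StepSizeBound (k₀ : ℕ) : Prop :=
  0 < alphaMax α ∧ ∀ k, k₀ ≤ k →
    alphaMax α * (theta B φ α k * lam k * (n * μ + n * L)) < 2 ∧
    alphaMax α * (2 * Real.sqrt n * L * sigmaA NA A φ k * lam k * NA (piSeq B k))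
      < 1 - sigmaA NA A φ k ∧
    alphaMax α * (2 * L * δB2 * xi NB B (k + 1) * lam (k + 1) * inducedNorm norm2 (A k))
      < 1 - sigmaB NB B k ∧
    alphaMax α * (e2 L μ A B lam α φ NA NB δAB δB2 k
        + Real.sqrt (e2 L μ A B lam α φ NA NB δAB δB2 k ^ 2
          + 4 * e1 L μ A B lam α φ NA NB δAB δB2 k * e3 L μ A B lam α φ NA NB δB2 k))
      < 2 * e3 L μ A B lam α φ NA NB δB2 k

end Coefficients

end WeightedGT

end

noncomputable section

namespace WeightedGT

open Matrix Filter Topology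

/-! ### Products of column-stochastic matrices on a strongly connected graph -/

/-! Three errors are followed: the gap `D` between the `φ_k`-weighted mean of the states and the
minimizer, the consensus error `C`, and the tracking error `R` of `y_k` against `π_k` times its sum.
Mixing by `A_k` leaves the weighted mean fixed, and the trackers always sum to `λ_k ∑ ∇f_i(x_i^k)`.
Hence the mean makes a gradient step of length of order `λ_k`, up to errors `O(λ_k C + R)`; its
length is bounded below in terms of `λ_k` because `φ_k` and, for large `k`, `π_k` are uniformly
positive. Strong monotonicity contracts `D` by `1 - c λ_k` (`norm_gradient_step_sub_le`).

`C` and `R` contract at a fixed rate in suitable norms. Long products of the weight matrices are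
entrywise positive, so they contract zero-sum vectors in `ℓ¹`; all words in the deflated matrices
then decay geometrically (`UniformlyCompatible.exists_decay`), and a supremum over words is a norm
contracted by every single matrix (`exists_adapted_seminorm`).

The local gradients need not vanish at the minimizer, so the change of weight drives `R` by a term
of order `λ_k - λ_{k+1}`, which is summable. A combination `V = D + s C + q R` satisfies `V_{k+1} ≤
(1 - c' λ_k + M (λ_k - λ_{k+1})) V_k + M (λ_k - λ_{k+1})` once `λ_k` is small, and divergence of `∑
λ_k` forces `V → 0` (`DecayingWeights.tendsto_zero_of_recursion`). -/

/-- Column-stochastic matrices whose entry `(i, j)` is at least `a` whenever `r j i` or `j = i`. -/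
structure UniformlyCompatible {n : ℕ} {ι : Type*} (r : Fin n → Fin n → Prop) (a : ℝ)
    (Q : ι → Matrix (Fin n) (Fin n) ℝ) : Prop where
  mem : ∀ k, Q k ∈ colStochastic ℝ (Fin n)
  le : ∀ k i j, (r j i ∨ j = i) → a ≤ Q k i j

lemma list_prod_mem_colStochastic {n : ℕ} {ι : Type*} {Q : ι → Matrix (Fin n) (Fin n) ℝ}
    (hQ : ∀ k, Q k ∈ colStochastic ℝ (Fin n)) (w : List ι) :
    (w.map Q).prod ∈ colStochastic ℝ (Fin n) := by
  refine Submonoid.list_prod_mem _ fun M hM => ?_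
  obtain ⟨k, -, rfl⟩ := List.mem_map.1 hM
  exact hQ k

/-- Each factor permits every edge of the graph, so a path can be followed along any word;
self-loops let it wait, so every sufficiently long word works. -/
lemma UniformlyCompatible.exists_length {n : ℕ} {ι : Type*} {r : Fin n → Fin n → Prop} {a : ℝ}
    {Q : ι → Matrix (Fin n) (Fin n) ℝ} (ha : 0 < a) (hQ : UniformlyCompatible r a Q)
    {j i : Fin n} (h : Relation.ReflTransGen r j i) :
    ∃ m : ℕ, ∀ w : List ι, m ≤ w.length → a ^ w.length ≤ (w.map Q).prod i j := by
  have step : ∀ (k : ι) (w : List ι) (i l : Fin n), (r l i ∨ l = i) →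
      a ^ w.length ≤ (w.map Q).prod l j → a ^ (k :: w).length ≤ ((k :: w).map Q).prod i j := by
    intro k w i l hl hw
    have hP := list_prod_mem_colStochastic hQ.mem w
    rw [List.map_cons, List.prod_cons, Matrix.mul_apply, List.length_cons, pow_succ']
    calc a * a ^ w.length ≤ Q k i l * (w.map Q).prod l j :=
          mul_le_mul (hQ.le k i l hl) hw (by positivity) ((hQ.mem k).1 i l)
      _ ≤ _ := Finset.single_le_sum
          (f := fun l => Q k i l * (w.map Q).prod l j)
          (fun l _ => mul_nonneg ((hQ.mem k).1 i l) (hP.1 l j)) (Finset.mem_univ l)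
  induction h with
  | refl =>
    refine ⟨0, fun w _ => ?_⟩
    induction w with
    | nil => simp
    | cons k w ih => exact step k w j j (Or.inr rfl) (ih (Nat.zero_le _))
  | @tail b c _ hbc ih =>
    obtain ⟨m, hm⟩ := ih
    refine ⟨m + 1, fun w hw => ?_⟩
    cases w with
    | nil => simp at hw
    | cons k w => exact step k w c b (Or.inl hbc) (hm w (by simpa using hw))

lemma UniformlyCompatible.exists_pos_le_prod {n : ℕ} {ι : Type*} {r : Fin n → Fin n → Prop}
    {a : ℝ} {Q : ι → Matrix (Fin n) (Fin n) ℝ} (ha : 0 < a) (hQ : UniformlyCompatible r a Q)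
    (hr : ∀ i j, Relation.ReflTransGen r i j) :
    ∃ m : ℕ, 0 < m ∧ ∃ ε : ℝ, 0 < ε ∧
      ∀ w : List ι, w.length = m → ∀ i j, ε ≤ (w.map Q).prod i j := by
  choose m hm using fun i j => hQ.exists_length ha (hr j i)
  -- The sum of all the lengths dominates each of them; the extra `1` keeps the block length
  -- positive.
  refine ⟨(∑ i, ∑ j, m i j) + 1, Nat.succ_pos _, a ^ ((∑ i, ∑ j, m i j) + 1), by positivity,
    fun w hw i j => ?_⟩
  rw [← hw]
  refine hm i j w ?_
  rw [hw]
  refine le_trans ?_ (Nat.le_succ _)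
  exact (Finset.single_le_sum (f := fun j => m i j) (fun _ _ => Nat.zero_le _)
    (Finset.mem_univ j)).trans
    (Finset.single_le_sum (f := fun i => ∑ j, m i j) (fun _ _ => Nat.zero_le _)
      (Finset.mem_univ i))

/-! ### Contraction in `ℓ¹` and adapted norms -/

/-- The `ℓ¹` norm on `ℝ^n`. -/
def l1 {n : ℕ} : Seminorm ℝ (Fin n → ℝ) :=
  Seminorm.of (fun v => ∑ i, |v i|)
    (fun u v => by
      rw [← Finset.sum_add_distrib]
      exact Finset.sum_le_sum fun i _ => abs_add_le _ _)
    (fun c v => by simp [abs_mul, Finset.mul_sum])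

lemma l1_apply {n : ℕ} (v : Fin n → ℝ) : l1 v = ∑ i, |v i| := rfl

lemma l1_mulVec_le_of_sum_le {n : ℕ} {M : Matrix (Fin n) (Fin n) ℝ} {c : ℝ}
    (hM : ∀ j, ∑ i, |M i j| ≤ c) (v : Fin n → ℝ) : l1 (M *ᵥ v) ≤ c * l1 v := by
  calc l1 (M *ᵥ v) ≤ ∑ i, ∑ j, |M i j| * |v j| := by
        rw [l1_apply]
        refine Finset.sum_le_sum fun i _ => ?_
        simp only [Matrix.mulVec, dotProduct, ← abs_mul]
        exact Finset.abs_sum_le_sum_abs (fun j => M i j * v j) Finset.univ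
    _ = ∑ j, (∑ i, |M i j|) * |v j| := by
        rw [Finset.sum_comm]
        simp only [Finset.sum_mul]
    _ ≤ ∑ j, c * |v j| := Finset.sum_le_sum fun j _ =>
        mul_le_mul_of_nonneg_right (hM j) (abs_nonneg _)
    _ = c * l1 v := by rw [l1_apply, Finset.mul_sum]

lemma l1_mulVec_le {n : ℕ} {M : Matrix (Fin n) (Fin n) ℝ} (hM : M ∈ colStochastic ℝ (Fin n))
    (v : Fin n → ℝ) : l1 (M *ᵥ v) ≤ l1 v := by
  have := l1_mulVec_le_of_sum_le (M := M) (c := 1) (fun j => by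
    rw [← sum_col_of_mem_colStochastic hM j]
    exact (Finset.sum_congr rfl fun i _ => abs_of_nonneg (hM.1 i j)).le) v
  simpa using this

/-- A column-stochastic matrix with entries at least `ε` contracts zero-sum vectors. -/
lemma l1_mulVec_le_of_sum_eq_zero {n : ℕ} {M : Matrix (Fin n) (Fin n) ℝ} {ε : ℝ}
    (hM : M ∈ colStochastic ℝ (Fin n)) (hε : ∀ i j, ε ≤ M i j) {v : Fin n → ℝ}
    (hv : ∑ i, v i = 0) : l1 (M *ᵥ v) ≤ (1 - n * ε) * l1 v := by
  -- On a zero-sum vector, lowering all entries by `ε` changes nothing, and it leaves a nonnegative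
  -- matrix with column sums `1 - n ε`.
  have h : M *ᵥ v = (Matrix.of fun i j => M i j - ε) *ᵥ v := by
    ext i
    simp [Matrix.mulVec, dotProduct, sub_mul, Finset.sum_sub_distrib, ← Finset.mul_sum, hv]
  rw [h]
  refine l1_mulVec_le_of_sum_le (fun j => le_of_eq ?_) v
  rw [← sum_col_of_mem_colStochastic hM j]
  calc ∑ i, |(Matrix.of fun i j => M i j - ε) i j| = ∑ i, (M i j - ε) :=
        Finset.sum_congr rfl fun i _ => abs_of_nonneg (sub_nonneg.2 (hε i j))
    _ = _ := by simp [Finset.sum_sub_distrib]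

/-- The matrices `Q k - ψ k 𝟏ᵀ`. -/
def deflated {n : ℕ} {ι : Type*} (Q : ι → Matrix (Fin n) (Fin n) ℝ) (ψ : ι → Fin n → ℝ) (k : ι) :
    Matrix (Fin n) (Fin n) ℝ :=
  Q k - vecMulVec (ψ k) fun _ => 1

/-- The rank-one terms annihilate zero-sum vectors, and column-stochastic factors keep a vector
zero-sum. -/
lemma deflated_prod_mulVec {n : ℕ} {ι : Type*} {Q : ι → Matrix (Fin n) (Fin n) ℝ}
    (hQ : ∀ k, Q k ∈ colStochastic ℝ (Fin n)) (ψ : ι → Fin n → ℝ) (w : List ι)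
    {v : Fin n → ℝ} (hv : ∑ i, v i = 0) :
    (w.map (deflated Q ψ)).prod *ᵥ v = (w.map Q).prod *ᵥ v := by
  induction w with
  | nil => simp
  | cons k w ih =>
    have h0 : ∑ i, ((w.map Q).prod *ᵥ v) i = 0 := by
      rw [sum_mulVec_of_mem_colStochastic (list_prod_mem_colStochastic hQ w), hv]
    rw [List.map_cons, List.prod_cons, ← Matrix.mulVec_mulVec, ih, List.map_cons, List.prod_cons,
      ← Matrix.mulVec_mulVec, deflated, Matrix.sub_mulVec, vecMulVec_mulVec]
    simp [dotProduct, h0]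

/-- Entries of products of the deflated matrices `Q k - ψ k 𝟏ᵀ`, in any order, decay
geometrically in the number of factors. -/
lemma UniformlyCompatible.exists_decay {n : ℕ} [NeZero n] {ι : Type*}
    {r : Fin n → Fin n → Prop} {a : ℝ} {Q : ι → Matrix (Fin n) (Fin n) ℝ} (ha : 0 < a)
    (hQ : UniformlyCompatible r a Q) (hr : ∀ i j, Relation.ReflTransGen r i j)
    {ψ : ι → Fin n → ℝ} (hψ : ∀ k, ψ k ∈ stdSimplex ℝ (Fin n)) :
    ∃ C γ : ℝ, 0 < γ ∧ γ < 1 ∧ ∀ (w : List ι) (i j : Fin n),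
      |(w.map (deflated Q ψ)).prod i j| ≤ C * γ ^ w.length := by
  obtain ⟨m, hm, ε, hε, hw⟩ := hQ.exists_pos_le_prod ha hr
  have hn : (0 : ℝ) < n := Nat.cast_pos.2 (Nat.pos_of_ne_zero (NeZero.ne n))
  -- Bernoulli's inequality gives a rate whose `m`-th power dominates the block contraction.
  obtain ⟨γ, hγ0, hγ1, hγm⟩ : ∃ γ : ℝ, 0 < γ ∧ γ < 1 ∧ 1 - n * ε ≤ γ ^ m := by
    set δ := min (n * ε) (1 / 2) with hδ
    have hδ0 : 0 < δ := lt_min (by positivity) (by norm_num)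
    have hδ1 : δ ≤ 1 / 2 := min_le_right _ _
    have hm1 : (1 : ℝ) ≤ m := by exact_mod_cast hm
    have hδm : δ / m ≤ δ := div_le_self hδ0.le hm1
    have hδm0 : 0 < δ / m := by positivity
    refine ⟨1 - δ / m, by linarith, by linarith, ?_⟩
    have hb := one_add_mul_le_pow (a := -(δ / m)) (by linarith) m
    have : (m : ℝ) * -(δ / m) = -δ := by field_simp
    rw [this, ← sub_eq_add_neg, ← sub_eq_add_neg] at hb
    exact (by linarith [min_le_left (n * ε) (1 / 2 : ℝ)] : 1 - n * ε ≤ 1 - δ).trans hb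
  -- Blocks of `m` letters are peeled off on the left, each gaining `γ ^ m`; the prefactor pays for
  -- the final incomplete block.
  have hzero : ∀ N : ℕ, ∀ w : List ι, w.length = N → ∀ v : Fin n → ℝ, ∑ i, v i = 0 →
      l1 ((w.map Q).prod *ᵥ v) ≤ (γ ^ m)⁻¹ * γ ^ w.length * l1 v := by
    intro N
    induction N using Nat.strong_induction_on with
    | _ N ih =>
      intro w hwN v hv
      by_cases hlt : w.length < m
      · refine (l1_mulVec_le (list_prod_mem_colStochastic hQ.mem w) v).trans ?_
        refine le_mul_of_one_le_left (apply_nonneg l1 v) ?_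
        rw [inv_mul_eq_div, one_le_div (by positivity)]
        exact pow_le_pow_of_le_one hγ0.le hγ1.le hlt.le
      · have hle : m ≤ w.length := not_lt.1 hlt
        have hlen : (w.take m).length = m := by simp [hle]
        have hsplit : (w.map Q).prod *ᵥ v
            = ((w.take m).map Q).prod *ᵥ (((w.drop m).map Q).prod *ᵥ v) := by
          rw [Matrix.mulVec_mulVec, ← List.prod_append, ← List.map_append, List.take_append_drop]
        have h0 : ∑ i, (((w.drop m).map Q).prod *ᵥ v) i = 0 := by
          rw [sum_mulVec_of_mem_colStochastic (list_prod_mem_colStochastic hQ.mem _), hv]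
        have hd : (w.drop m).length = w.length - m := by simp
        rw [hsplit]
        calc _ ≤ (1 - n * ε) * l1 (((w.drop m).map Q).prod *ᵥ v) :=
              l1_mulVec_le_of_sum_eq_zero (list_prod_mem_colStochastic hQ.mem _) (hw _ hlen) h0
          _ ≤ γ ^ m * ((γ ^ m)⁻¹ * γ ^ (w.drop m).length * l1 v) :=
              mul_le_mul hγm (ih _ (by omega) _ rfl v hv) (apply_nonneg _ _) (by positivity)
          _ = (γ ^ m)⁻¹ * (γ ^ m * γ ^ (w.length - m)) * l1 v := by rw [hd]; ring
          _ = _ := by rw [← pow_add, Nat.add_sub_cancel' hle]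
  have hQψ : ∀ k (v : Fin n → ℝ), l1 ((deflated Q ψ k) *ᵥ v) ≤ 2 * l1 v := by
    intro k v
    refine l1_mulVec_le_of_sum_le (fun j => ?_) v
    calc ∑ i, |(deflated Q ψ k) i j| ≤ ∑ i, (Q k i j + ψ k i) := by
          refine Finset.sum_le_sum fun i _ => ?_
          have h1 := (hQ.mem k).1 i j
          have h2 := (hψ k).1 i
          simp only [deflated, Matrix.sub_apply, vecMulVec_apply, mul_one]
          exact abs_le.2 ⟨by linarith, by linarith⟩
      _ = 2 := by
          rw [Finset.sum_add_distrib, sum_col_of_mem_colStochastic (hQ.mem k), (hψ k).2]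
          norm_num
  have hsum : ∀ k (v : Fin n → ℝ), ∑ i, ((deflated Q ψ k) *ᵥ v) i = 0 := by
    intro k v
    simp only [deflated, Matrix.sub_mulVec, vecMulVec_mulVec, Pi.sub_apply, Finset.sum_sub_distrib,
      sum_mulVec_of_mem_colStochastic (hQ.mem k)]
    have := (hψ k).2
    simp [dotProduct, ← Finset.sum_mul, this]
  have hentry : ∀ (M : Matrix (Fin n) (Fin n) ℝ) i j, |M i j| ≤ l1 (M *ᵥ Pi.single j 1) := by
    intro M i j
    rw [l1_apply]
    refine le_trans (le_of_eq ?_) (Finset.single_le_sum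
      (f := fun i => |(M *ᵥ Pi.single j 1) i|) (fun _ _ => abs_nonneg _) (Finset.mem_univ i))
    simp
  have hsingle : ∀ j : Fin n, l1 (Pi.single j (1 : ℝ)) = 1 := by
    intro j
    rw [l1_apply, Finset.sum_eq_single j] <;> simp +contextual
  -- The rightmost factor sends every vector to a zero-sum one at cost `2`, after which `hzero`
  -- applies; `γ⁻¹` accounts for that letter, and the `1` covers the empty word.
  refine ⟨max 1 (2 * (γ ^ m)⁻¹ * γ⁻¹), γ, hγ0, hγ1, fun w i j => ?_⟩
  refine (hentry _ i j).trans ?_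
  rcases List.eq_nil_or_concat w with rfl | ⟨w, k, rfl⟩
  · rw [List.map_nil, List.prod_nil, Matrix.one_mulVec, hsingle]
    simp
  · rw [List.concat_eq_append, List.map_append, List.prod_append, ← Matrix.mulVec_mulVec, List.map_singleton,
      List.prod_singleton, deflated_prod_mulVec hQ.mem ψ w (hsum k _)]
    calc _ ≤ (γ ^ m)⁻¹ * γ ^ w.length * l1 ((deflated Q ψ k) *ᵥ Pi.single j 1) :=
          hzero _ w rfl _ (hsum k _)
      _ ≤ (γ ^ m)⁻¹ * γ ^ w.length * (2 * l1 (Pi.single j 1)) := by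
          gcongr
          exact hQψ k _
      _ = 2 * (γ ^ m)⁻¹ * γ⁻¹ * γ ^ (w ++ [k]).length := by
          rw [hsingle, List.length_append, List.length_singleton, pow_succ]
          field_simp
      _ ≤ _ := by
          gcongr
          exact le_max_right _ _

/-- A family of matrices whose products decay geometrically contracts an adapted norm. -/
lemma exists_adapted_seminorm {n : ℕ} {ι : Type*} {T : ι → Matrix (Fin n) (Fin n) ℝ} {C γ : ℝ}
    (hγ : 0 < γ)
    (hT : ∀ (w : List ι) (i j : Fin n), |(w.map T).prod i j| ≤ C * γ ^ w.length) :
    ∃ N : Seminorm ℝ (Fin n → ℝ), (∀ v, l1 v ≤ N v) ∧ ∀ k v, N (T k *ᵥ v) ≤ γ * N v := by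
  -- The norm is the supremum of these over all words. The empty word gives domination of `ℓ¹`;
  -- applying `T k` appends the letter `k`, and the rescaling releases a factor `γ`.
  let p : List ι → Seminorm ℝ (Fin n → ℝ) := fun w =>
    (Real.toNNReal ((γ ^ w.length)⁻¹)) • l1.comp (Matrix.mulVecLin (w.map T).prod)
  have hp : ∀ w v, p w v = (γ ^ w.length)⁻¹ * l1 ((w.map T).prod *ᵥ v) := by
    intro w v
    have : 0 ≤ (γ ^ w.length)⁻¹ := by positivity
    simp [p, NNReal.smul_def, Real.coe_toNNReal _ this]
  have hbound : ∀ w v, p w v ≤ n * C * l1 v := by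
    intro w v
    rw [hp, inv_mul_le_iff₀ (by positivity)]
    refine (l1_mulVec_le_of_sum_le (c := n * (C * γ ^ w.length)) (fun j => ?_) v).trans
      (le_of_eq (by ring))
    calc _ ≤ ∑ _i : Fin n, C * γ ^ w.length := Finset.sum_le_sum fun i _ => hT w i j
      _ = _ := by simp
  have hbdd : BddAbove (Set.range p) := by
    rw [Seminorm.bddAbove_range_iff]
    exact fun v => ⟨n * C * l1 v, Set.forall_mem_range.2 fun w => hbound w v⟩
  have hbdd' : ∀ v, BddAbove (Set.range fun w => p w v) := fun v =>
    ⟨n * C * l1 v, Set.forall_mem_range.2 fun w => hbound w v⟩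
  refine ⟨⨆ w, p w, fun v => ?_, fun k v => ?_⟩
  · rw [Seminorm.iSup_apply hbdd]
    refine le_ciSup_of_le (hbdd' v) [] ?_
    rw [hp]
    simp
  · rw [Seminorm.iSup_apply hbdd, Seminorm.iSup_apply hbdd]
    refine ciSup_le fun w => ?_
    have h : p w (T k *ᵥ v) = γ * p (w ++ [k]) v := by
      rw [hp, hp, List.map_append, List.prod_append, ← Matrix.mulVec_mulVec, List.length_append,
        pow_add]
      simp
      field_simp
    rw [h]
    exact mul_le_mul_of_nonneg_left (le_ciSup (hbdd' v) _) hγ.le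

/-! ### Uniform positivity of stochastic sequences -/

lemma le_mulVec_of_mem_stdSimplex {n : ℕ} {M : Matrix (Fin n) (Fin n) ℝ} {ε : ℝ}
    (hε : ∀ i j, ε ≤ M i j) {v : Fin n → ℝ} (hv : v ∈ stdSimplex ℝ (Fin n)) (i : Fin n) :
    ε ≤ (M *ᵥ v) i := by
  calc ε = ∑ j, ε * v j := by rw [← Finset.mul_sum, hv.2, mul_one]
    _ ≤ ∑ j, M i j * v j :=
        Finset.sum_le_sum fun j _ => mul_le_mul_of_nonneg_right (hε i j) (hv.1 j)

lemma mulVec_mem_stdSimplex {n : ℕ} {M : Matrix (Fin n) (Fin n) ℝ}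
    (hM : M ∈ colStochastic ℝ (Fin n)) {v : Fin n → ℝ} (hv : v ∈ stdSimplex ℝ (Fin n)) :
    M *ᵥ v ∈ stdSimplex ℝ (Fin n) :=
  ⟨nonneg_mulVec_of_mem_colStochastic hM hv.1,
    (sum_mulVec_of_mem_colStochastic hM).trans hv.2⟩

/-- From index `m` on, `u k` is a product of `m` factors applied to a stochastic vector, hence an
average of columns with entries at least `ε`. -/
lemma UniformlyCompatible.exists_eventually_le_of_forward {n : ℕ} {r : Fin n → Fin n → Prop}
    {a : ℝ} {Q : ℕ → Matrix (Fin n) (Fin n) ℝ} (ha : 0 < a) (hQ : UniformlyCompatible r a Q)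
    (hr : ∀ i j, Relation.ReflTransGen r i j) {u : ℕ → Fin n → ℝ}
    (hu : ∀ k, u k ∈ stdSimplex ℝ (Fin n)) (hstep : ∀ k, u (k + 1) = Q k *ᵥ u k) :
    ∃ ε : ℝ, 0 < ε ∧ ∃ m : ℕ, ∀ k, m ≤ k → ∀ i, ε ≤ u k i := by
  obtain ⟨m, -, ε, hε, hw⟩ := hQ.exists_pos_le_prod ha hr
  have hword : ∀ l k, ∃ w : List ℕ, w.length = l ∧ u (k + l) = (w.map Q).prod *ᵥ u k := by
    intro l k
    induction l with
    | zero => exact ⟨[], rfl, by simp⟩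
    | succ l ih =>
      obtain ⟨w, hwl, hwu⟩ := ih
      exact ⟨(k + l) :: w, by simp [hwl], by
        rw [← add_assoc, hstep, hwu, List.map_cons, List.prod_cons, Matrix.mulVec_mulVec]⟩
  refine ⟨ε, hε, m, fun k hk i => ?_⟩
  obtain ⟨w, hwl, hwu⟩ := hword m (k - m)
  rw [← Nat.sub_add_cancel hk, hwu]
  exact le_mulVec_of_mem_stdSimplex (hw w hwl) (hu _) i

/-- As in the forward case, but the `m` factors lie in the future and are always available, so no
initial indices are lost. -/
lemma UniformlyCompatible.exists_le_of_backward {n : ℕ} {r : Fin n → Fin n → Prop}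
    {a : ℝ} {Q : ℕ → Matrix (Fin n) (Fin n) ℝ} (ha : 0 < a) (hQ : UniformlyCompatible r a Q)
    (hr : ∀ i j, Relation.ReflTransGen r i j) {u : ℕ → Fin n → ℝ}
    (hu : ∀ k, u k ∈ stdSimplex ℝ (Fin n)) (hstep : ∀ k, u k = Q k *ᵥ u (k + 1)) :
    ∃ ε : ℝ, 0 < ε ∧ ∀ k i, ε ≤ u k i := by
  obtain ⟨m, -, ε, hε, hw⟩ := hQ.exists_pos_le_prod ha hr
  have hword : ∀ l k, ∃ w : List ℕ, w.length = l ∧ u k = (w.map Q).prod *ᵥ u (k + l) := by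
    intro l
    induction l with
    | zero => exact fun k => ⟨[], rfl, by simp⟩
    | succ l ih =>
      intro k
      obtain ⟨w, hwl, hwu⟩ := ih (k + 1)
      refine ⟨k :: w, by simp [hwl], ?_⟩
      rw [hstep, hwu, List.map_cons, List.prod_cons, Matrix.mulVec_mulVec, add_assoc, add_comm 1 l]
  refine ⟨ε, hε, fun k i => ?_⟩
  obtain ⟨w, hwl, hwu⟩ := hword m k
  rw [hwu]
  exact le_mulVec_of_mem_stdSimplex (hw w hwl) (hu _) i

/-! ### The two families of weight matrices -/

lemma ColStochasticCompatible.exists_uniformlyCompatible {n : ℕ} {G : Digraph (Fin n)}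
    {B : ℕ → Matrix (Fin n) (Fin n) ℝ} (hB : ColStochasticCompatible G B) :
    ∃ b : ℝ, 0 < b ∧ UniformlyCompatible G.Adj b fun k => B (k + 1) := by
  obtain ⟨b, hb, h⟩ := hB
  refine ⟨b, hb, fun k => mem_colStochastic_iff_sum.2 ⟨fun i j => ?_, (h _ k.succ_pos).2.2⟩,
    fun k i j hij => (h _ k.succ_pos).1 i j (hij.imp_right Eq.symm)⟩
  by_cases hij : G.Adj j i ∨ i = j
  · exact hb.le.trans ((h _ k.succ_pos).1 i j hij)
  · exact ((h _ k.succ_pos).2.1 i j hij).ge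

/-- Transposing makes the matrices column-stochastic and reverses the edges; the shift by one drops
the unconstrained index `0`. -/
lemma RowStochasticCompatible.exists_uniformlyCompatible {n : ℕ} {G : Digraph (Fin n)}
    {A : ℕ → Matrix (Fin n) (Fin n) ℝ} (hA : RowStochasticCompatible G A) :
    ∃ a : ℝ, 0 < a ∧ UniformlyCompatible (Function.swap G.Adj) a fun k => (A (k + 1))ᵀ := by
  obtain ⟨a, ha, h⟩ := hA
  refine ⟨a, ha, fun k => mem_colStochastic_iff_sum.2 ⟨fun i j => ?_, (h _ k.succ_pos).2.2⟩,
    fun k i j hij => (h _ k.succ_pos).1 j i (hij.imp_right Eq.symm)⟩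
  by_cases hij : G.Adj i j ∨ i = j
  · exact ha.le.trans ((h _ k.succ_pos).1 j i hij)
  · exact ((h _ k.succ_pos).2.1 j i hij).ge

lemma StronglyConnected.swap {n : ℕ} {G : Digraph (Fin n)} (hG : StronglyConnected G)
    (i j : Fin n) : Relation.ReflTransGen (Function.swap G.Adj) i j :=
  (hG j i).swap

lemma piSeq_mem_stdSimplex {n : ℕ} [NeZero n] {B : ℕ → Matrix (Fin n) (Fin n) ℝ}
    (hB : ∀ k, B (k + 1) ∈ colStochastic ℝ (Fin n)) (k : ℕ) :
    piSeq B (k + 1) ∈ stdSimplex ℝ (Fin n) := by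
  induction k with
  | zero =>
    have : (n : ℝ) ≠ 0 := Nat.cast_ne_zero.2 (NeZero.ne n)
    refine ⟨fun i => ?_, ?_⟩
    · simp only [piSeq]; positivity
    · simp [piSeq, this]
  | succ k ih => exact mulVec_mem_stdSimplex (hB k) ih

lemma IsAbsoluteProbabilitySequence.mem_stdSimplex {n : ℕ} {A : ℕ → Matrix (Fin n) (Fin n) ℝ}
    {φ : ℕ → Fin n → ℝ} (hφ : IsAbsoluteProbabilitySequence A φ) (k : ℕ) :
    φ (k + 1) ∈ stdSimplex ℝ (Fin n) :=
  ⟨hφ.nonneg _ k.succ_pos, hφ.sum_eq_one _ k.succ_pos⟩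

/-- Absolute probability sequences exist, by compactness. -/
lemma exists_isAbsoluteProbabilitySequence {n : ℕ} [NeZero n] {A : ℕ → Matrix (Fin n) (Fin n) ℝ}
    (hA : ∀ k, (A (k + 1))ᵀ ∈ colStochastic ℝ (Fin n)) :
    ∃ φ, IsAbsoluteProbabilitySequence A φ := by
  let S : Set (ℕ → Fin n → ℝ) := Set.univ.pi fun _ => stdSimplex ℝ (Fin n)
  have hS : IsCompact S := isCompact_univ_pi fun _ => isCompact_stdSimplex ℝ (Fin n)
  have hcont : ∀ k, Continuous fun u : ℕ → Fin n → ℝ => (A (k + 1))ᵀ *ᵥ u (k + 2) := fun k =>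
    Continuous.matrix_mulVec continuous_const (continuous_apply _)
  -- Sequences obeying the first `m` relations form nested closed nonempty subsets of a compact
  -- product; a point of the intersection obeys all of them.
  let t : ℕ → Set (ℕ → Fin n → ℝ) := fun m =>
    S ∩ {u | ∀ k < m, (A (k + 1))ᵀ *ᵥ u (k + 2) = u (k + 1)}
  have htc : ∀ m, IsClosed (t m) := by
    intro m
    refine hS.isClosed.inter ?_
    simp only [Set.ofPred_forall]
    exact isClosed_iInter fun k => isClosed_iInter fun _ =>
      isClosed_eq (hcont k) (continuous_apply _)
  have hne : ∀ m, (t m).Nonempty := by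
    intro m
    have hseq : ∃ v : ℕ → Fin n → ℝ, (∀ k, v k ∈ stdSimplex ℝ (Fin n)) ∧
        ∀ k, 1 ≤ k → k ≤ m → v k = (A k)ᵀ *ᵥ v (k + 1) := by
      let e : Fin n → ℝ := Pi.single 0 1
      have he : e ∈ stdSimplex ℝ (Fin n) := single_mem_stdSimplex ℝ 0
      -- `g l` is the vector at time `m + 1 - l`: time runs backward from an arbitrary stochastic
      -- vector and freezes after `m` steps, so `A 0` never enters.
      let g : ℕ → Fin n → ℝ := fun l =>
        Nat.rec e (fun l v => if l < m then (A (m - l))ᵀ *ᵥ v else v) l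
      have hg : ∀ l, g (l + 1) = if l < m then (A (m - l))ᵀ *ᵥ g l else g l := fun l => rfl
      have hgm : ∀ l, g l ∈ stdSimplex ℝ (Fin n) := by
        intro l
        induction l with
        | zero => exact he
        | succ l ih =>
          rw [hg]
          split_ifs with h
          · obtain ⟨q, hq⟩ : ∃ q, m - l = q + 1 := ⟨m - l - 1, by omega⟩
            rw [hq]
            exact mulVec_mem_stdSimplex (hA q) ih
          · exact ih
      refine ⟨fun k => g (m + 1 - k), fun k => hgm _, fun k hk hkm => ?_⟩
      have h1 : m + 1 - k = (m - k) + 1 := by omega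
      have h2 : m + 1 - (k + 1) = m - k := by omega
      have h3 : m - (m - k) = k := by omega
      simp only
      rw [h2, h1, hg, if_pos (by omega), h3]
    obtain ⟨v, hv, hvs⟩ := hseq
    exact ⟨v, fun k _ => hv k, fun k hk => (hvs (k + 1) (by omega) (by omega)).symm⟩
  obtain ⟨φ, hφ⟩ := IsCompact.nonempty_iInter_of_sequence_nonempty_isCompact_isClosed t
    (fun m u hu => ⟨hu.1, fun k hk => hu.2 k (by omega)⟩) hne
    (hS.of_isClosed_subset (htc 0) Set.inter_subset_left) htc
  rw [Set.mem_iInter] at hφ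
  refine ⟨φ, fun k _ => ((hφ 0).1 k trivial).1, fun k _ => ((hφ 0).1 k trivial).2,
    fun k hk => ?_⟩
  obtain ⟨q, rfl⟩ : ∃ q, k = q + 1 := ⟨k - 1, by omega⟩
  rw [← Matrix.mulVec_transpose]
  exact (hφ (q + 1)).2 q (by omega)

/-- A single norm is contracted at a uniform rate by all the matrices `B k - π k 𝟏ᵀ`. -/
lemma exists_contracted_seminorm_of_col {n : ℕ} [NeZero n] {G : Digraph (Fin n)}
    (hG : StronglyConnected G) {B : ℕ → Matrix (Fin n) (Fin n) ℝ}
    (hB : ColStochasticCompatible G B) :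
    ∃ (N : Seminorm ℝ (Fin n → ℝ)) (γ : ℝ), 0 < γ ∧ γ < 1 ∧ (∀ v, l1 v ≤ N v) ∧
      ∀ k, 1 ≤ k → ∀ v, N ((B k - vecMulVec (piSeq B k) fun _ => 1) *ᵥ v) ≤ γ * N v := by
  obtain ⟨b, hb, hQ⟩ := hB.exists_uniformlyCompatible
  obtain ⟨C, γ, h0, h1, hd⟩ := hQ.exists_decay hb hG (piSeq_mem_stdSimplex hQ.mem)
  obtain ⟨N, hN, hc⟩ := exists_adapted_seminorm h0 hd
  refine ⟨N, γ, h0, h1, hN, fun k hk => ?_⟩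
  obtain ⟨q, rfl⟩ : ∃ q, k = q + 1 := ⟨k - 1, by omega⟩
  exact hc q

/-- A single norm is contracted at a uniform rate by all the matrices `A k - 𝟏 (φ k)ᵀ`. -/
lemma exists_contracted_seminorm_of_row {n : ℕ} [NeZero n] {G : Digraph (Fin n)}
    (hG : StronglyConnected G) {A : ℕ → Matrix (Fin n) (Fin n) ℝ}
    (hA : RowStochasticCompatible G A) {φ : ℕ → Fin n → ℝ}
    (hφ : IsAbsoluteProbabilitySequence A φ) :
    ∃ (N : Seminorm ℝ (Fin n → ℝ)) (γ : ℝ), 0 < γ ∧ γ < 1 ∧ (∀ v, l1 v ≤ N v) ∧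
      ∀ k, 1 ≤ k → ∀ v, N ((A k - vecMulVec (fun _ => 1) (φ k)) *ᵥ v) ≤ γ * N v := by
  obtain ⟨a, ha, hQ⟩ := hA.exists_uniformlyCompatible
  obtain ⟨C, γ, h0, h1, hd⟩ := hQ.exists_decay ha hG.swap hφ.mem_stdSimplex
  -- The matrices `A k - 𝟏 (φ k)ᵀ` are the transposes of these. Transposition reverses words, which
  -- is harmless because the decay holds for words in any order.
  set D := deflated (fun k => (A (k + 1))ᵀ) fun k => φ (k + 1) with hD
  obtain ⟨N, hN, hc⟩ := exists_adapted_seminorm (T := fun k => (D k)ᵀ) (C := C) h0 (by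
    intro w i j
    have h : (w.map fun k => (D k)ᵀ).prod = (w.reverse.map D).prodᵀ := by
      rw [Matrix.transpose_list_prod, List.map_reverse, List.map_reverse, List.reverse_reverse,
        List.map_map]
      rfl
    rw [h, Matrix.transpose_apply, ← List.length_reverse]
    exact hd _ j i)
  refine ⟨N, γ, h0, h1, hN, fun k hk v => ?_⟩
  obtain ⟨q, rfl⟩ : ∃ q, k = q + 1 := ⟨k - 1, by omega⟩
  have h : A (q + 1) - vecMulVec (fun _ => 1) (φ (q + 1)) = (D q)ᵀ := by
    rw [hD, deflated, Matrix.transpose_sub, Matrix.transpose_vecMulVec, Matrix.transpose_transpose]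
  rw [h]
  exact hc q v

/-! ### Comparison of norms and existence of admissible ones -/

lemma norm2_le_l1 {n : ℕ} (v : Fin n → ℝ) : norm2 v ≤ l1 v := by
  refine Real.sqrt_le_iff.2 ⟨apply_nonneg _ _, ?_⟩
  rw [l1_apply]
  simp only [← sq_abs (v _)]
  exact Finset.sum_sq_le_sq_sum_of_nonneg fun i _ => abs_nonneg _

lemma abs_le_norm2 {n : ℕ} (v : Fin n → ℝ) (i : Fin n) : |v i| ≤ norm2 v :=
  Real.abs_le_sqrt (Finset.single_le_sum (f := fun i => v i ^ 2) (fun _ _ => sq_nonneg _)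
    (Finset.mem_univ i))

lemma seminorm_le_sum_abs {n : ℕ} (N : Seminorm ℝ (Fin n → ℝ)) (v : Fin n → ℝ) :
    N v ≤ ∑ i, |v i| * N (Pi.single i 1) := by
  calc N v = N (∑ i, v i • Pi.single i (1 : ℝ)) := by
        congr 1
        ext j
        simp [Finset.sum_apply, Pi.single_apply]
    _ ≤ ∑ i, N (v i • Pi.single i (1 : ℝ)) := Finset.le_sum_of_subadditive N (map_zero N).le (map_add_le_add N) _ _
    _ = _ := by simp [map_smul_eq_mul]

lemma exists_seminorm_le_norm2 {n : ℕ} (N : Seminorm ℝ (Fin n → ℝ)) :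
    ∃ C : ℝ, 0 < C ∧ ∀ v, N v ≤ C * norm2 v := by
  have h0 : 0 ≤ ∑ i, N (Pi.single i (1 : ℝ)) := Finset.sum_nonneg fun _ _ => apply_nonneg _ _
  refine ⟨∑ i, N (Pi.single i (1 : ℝ)) + 1, by linarith, fun v => ?_⟩
  calc N v ≤ ∑ i, |v i| * N (Pi.single i 1) := seminorm_le_sum_abs N v
    _ ≤ ∑ i, norm2 v * N (Pi.single i 1) := Finset.sum_le_sum fun i _ =>
        mul_le_mul_of_nonneg_right (abs_le_norm2 v i) (apply_nonneg _ _)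
    _ = (∑ i, N (Pi.single i (1 : ℝ))) * norm2 v := by rw [← Finset.mul_sum, mul_comm]
    _ ≤ _ := mul_le_mul_of_nonneg_right (by linarith) (Real.sqrt_nonneg _)

lemma inducedNorm_le {n : ℕ} {N : (Fin n → ℝ) → ℝ} {M : Matrix (Fin n) (Fin n) ℝ} {c : ℝ}
    (hc : 0 ≤ c) (h : ∀ v, N (M *ᵥ v) ≤ c * N v) : inducedNorm N M ≤ c :=
  csInf_le ⟨0, fun _ hx => hx.1⟩ ⟨hc, h⟩

/-- The contraction rates bound the induced norms. The constant comparing `NA` with the Euclidean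
norm also serves as `δAB`, because `NB` dominates the Euclidean norm. -/
lemma exists_admissibleNorms {n : ℕ} [NeZero n] {G : Digraph (Fin n)}
    (hG : StronglyConnected G) {A B : ℕ → Matrix (Fin n) (Fin n) ℝ}
    (hA : RowStochasticCompatible G A) (hB : ColStochasticCompatible G B) {φ : ℕ → Fin n → ℝ}
    (hφ : IsAbsoluteProbabilitySequence A φ) :
    ∃ (NA NB : Seminorm ℝ (Fin n → ℝ)) (δAB δB2 : ℝ), AdmissibleNorms A B φ NA NB δAB δB2 := by
  obtain ⟨NA, γA, hA0, hA1, hNA, hcA⟩ := exists_contracted_seminorm_of_row hG hA hφ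
  obtain ⟨NB, γB, hB0, hB1, hNB, hcB⟩ := exists_contracted_seminorm_of_col hG hB
  obtain ⟨CA, hCA, hCA'⟩ := exists_seminorm_le_norm2 NA
  obtain ⟨CB, hCB, hCB'⟩ := exists_seminorm_le_norm2 NB
  have h2B : ∀ v, norm2 v ≤ NB v := fun v => (norm2_le_l1 v).trans (hNB v)
  exact ⟨NA, NB, CA, CB, {
    norm2_le_A := fun v => (norm2_le_l1 v).trans (hNA v)
    norm2_le_B := h2B
    sigmaA_lt_one := fun k hk => (inducedNorm_le hA0.le (hcA k hk)).trans_lt hA1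
    sigmaB_lt_one := fun k hk => (inducedNorm_le hB0.le (hcB k hk)).trans_lt hB1
    δAB_pos := hCA
    δB2_pos := hCB
    A_le_B := fun v => (hCA' v).trans (mul_le_mul_of_nonneg_left (h2B v) hCA.le)
    B_le_norm2 := hCB' }⟩

/-! ### Norms on stacked decision vectors -/

/-- A seminorm on `ℝ^n`, summed over the coordinates of stacked decision vectors. -/
def stackedSeminorm {n p : ℕ} (N : Seminorm ℝ (Fin n → ℝ)) : Seminorm ℝ (Fin n → Vec p) :=
  ∑ c, N.comp (LinearMap.pi fun i =>
    (EuclideanSpace.proj c : Vec p →L[ℝ] ℝ).toLinearMap ∘ₗ LinearMap.proj i)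

lemma stackedSeminorm_apply {n p : ℕ} (N : Seminorm ℝ (Fin n → ℝ)) (X : Fin n → Vec p) :
    stackedSeminorm N X = ∑ c, N fun i => X i c := by
  rw [stackedSeminorm, ← FunLike.coeAddMonoidHom_apply, map_sum, Finset.sum_apply]
  rfl

/-- Mixing acts separately on each coordinate of `ℝ^p`, so summing over coordinates preserves the
contraction constant. -/
lemma stackedSeminorm_mulVec_le {n p : ℕ} {N : Seminorm ℝ (Fin n → ℝ)}
    {M : Matrix (Fin n) (Fin n) ℝ} {γ : ℝ} (h : ∀ v, N (M *ᵥ v) ≤ γ * N v)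
    (X : Fin n → Vec p) :
    stackedSeminorm N (fun i => ∑ j, M i j • X j) ≤ γ * stackedSeminorm N X := by
  simp only [stackedSeminorm_apply, Finset.mul_sum]
  refine Finset.sum_le_sum fun c _ => le_trans (le_of_eq ?_) (h _)
  congr 1
  ext i
  simp [Matrix.mulVec, dotProduct]

lemma norm_le_sum_abs {p : ℕ} (v : Vec p) : ‖v‖ ≤ ∑ c, |v c| := by
  rw [EuclideanSpace.norm_eq]
  simpa [norm2, l1_apply] using norm2_le_l1 (fun c => v c)

lemma norm_le_stackedSeminorm {n p : ℕ} {N : Seminorm ℝ (Fin n → ℝ)} (h : ∀ v, l1 v ≤ N v)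
    (X : Fin n → Vec p) : ‖X‖ ≤ stackedSeminorm N X := by
  refine (pi_norm_le_iff_of_nonneg (apply_nonneg _ _)).2 fun i => (norm_le_sum_abs _).trans ?_
  rw [stackedSeminorm_apply]
  refine Finset.sum_le_sum fun c _ => le_trans ?_ (h _)
  exact Finset.single_le_sum (f := fun i => |X i c|) (fun _ _ => abs_nonneg _) (Finset.mem_univ i)

lemma exists_stackedSeminorm_le {n : ℕ} (p : ℕ) (N : Seminorm ℝ (Fin n → ℝ)) :
    ∃ C : ℝ, 0 ≤ C ∧ ∀ X : Fin n → Vec p, stackedSeminorm N X ≤ C * ‖X‖ := by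
  refine ⟨∑ _c : Fin p, ∑ i, N (Pi.single i (1 : ℝ)), Finset.sum_nonneg fun _ _ =>
    Finset.sum_nonneg fun _ _ => apply_nonneg _ _, fun X => ?_⟩
  rw [stackedSeminorm_apply, Finset.sum_mul]
  refine Finset.sum_le_sum fun c _ => (seminorm_le_sum_abs N _).trans ?_
  rw [Finset.sum_mul]
  refine Finset.sum_le_sum fun i _ => ?_
  rw [mul_comm]
  refine mul_le_mul_of_nonneg_left ?_ (apply_nonneg _ _)
  exact (PiLp.norm_apply_le (X i) c).trans (norm_le_pi_norm X i)

/-! ### Strongly monotone Lipschitz maps and the minimizer -/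

section Monotone

variable {E : Type*} [NormedAddCommGroup E] [InnerProductSpace ℝ E]

/-- Expanding the square gives the factor `1 - 2ηm + η²Λ² ≤ 1 - ηm ≤ (1 - ηm/2)²`; `ηm ≤ 1` makes
the base nonnegative. -/
lemma norm_gradient_step_sub_le {F : E → E} {Λ m η : ℝ}
    (hF : ∀ x u, ‖F x - F u‖ ≤ Λ * ‖x - u‖)
    (hm : ∀ x u, m * ‖x - u‖ ^ 2 ≤ inner ℝ (F x - F u) (x - u))
    (hη : 0 ≤ η) (hηΛ : η * Λ ^ 2 ≤ m) (hηm : η * m ≤ 1) (x u : E) :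
    ‖(x - η • F x) - (u - η • F u)‖ ≤ (1 - η * m / 2) * ‖x - u‖ := by
  refine le_of_sq_le_sq ?_ (mul_nonneg (by linarith) (norm_nonneg _))
  have h1 : (x - η • F x) - (u - η • F u) = (x - u) - η • (F x - F u) := by
    rw [smul_sub]; abel
  have h2 : ‖F x - F u‖ ^ 2 ≤ Λ ^ 2 * ‖x - u‖ ^ 2 := by
    rw [← mul_pow]
    exact pow_le_pow_left₀ (norm_nonneg _) (hF x u) 2
  rw [h1, norm_sub_sq_real, norm_smul, Real.norm_of_nonneg hη, real_inner_smul_right,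
    real_inner_comm]
  have h3 := mul_le_mul_of_nonneg_left (hm x u) hη
  have h4 := mul_le_mul_of_nonneg_left h2 (mul_nonneg hη hη)
  have h5 := mul_le_mul_of_nonneg_right hηΛ (mul_nonneg hη (sq_nonneg ‖x - u‖))
  have h6 : 0 ≤ (η * m / 2 * ‖x - u‖) ^ 2 := sq_nonneg _
  nlinarith

/-- Banach's fixed point theorem for the gradient step. The denominator `Λ ^ 2 + m ^ 2` meets both
step-length conditions without comparing `m` with `Λ`. -/
lemma exists_zero_of_strongly_monotone [CompleteSpace E] {F : E → E} {Λ m : ℝ} (hm0 : 0 < m)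
    (hF : ∀ x u, ‖F x - F u‖ ≤ Λ * ‖x - u‖)
    (hm : ∀ x u, m * ‖x - u‖ ^ 2 ≤ inner ℝ (F x - F u) (x - u)) : ∃ x, F x = 0 := by
  set η := m / (Λ ^ 2 + m ^ 2) with hη
  have hden : 0 < Λ ^ 2 + m ^ 2 := by positivity
  have hη0 : 0 < η := by positivity
  have hηΛ : η * Λ ^ 2 ≤ m := by
    rw [hη, div_mul_eq_mul_div, div_le_iff₀ hden]
    nlinarith [pow_pos hm0 3]
  have hηm : η * m ≤ 1 := by
    rw [hη, div_mul_eq_mul_div, div_le_iff₀ hden]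
    nlinarith [sq_nonneg Λ]
  have hc : ContractingWith (Real.toNNReal (1 - η * m / 2)) fun x => x - η • F x := by
    have hpos : 0 < η * m := by positivity
    refine ⟨?_, LipschitzWith.of_dist_le_mul fun x u => ?_⟩
    · rw [Real.toNNReal_lt_one]
      linarith
    · rw [dist_eq_norm, dist_eq_norm, Real.coe_toNNReal _ (by linarith)]
      exact norm_gradient_step_sub_le hF hm hη0.le hηΛ hηm x u
  refine ⟨hc.fixedPoint _, ?_⟩
  have h := hc.fixedPoint_isFixedPt
  rw [Function.IsFixedPt, sub_eq_self, smul_eq_zero] at h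
  exact h.resolve_left hη0.ne'

/-- Along the ray from `x` through `z`, monotonicity of `F` against `F x = 0` makes the derivative
nonnegative. -/
lemma isMinOn_of_gradient_eq_zero [CompleteSpace E] {f : E → ℝ} {F : E → E}
    (hf : ∀ x, HasGradientAt f (F x) x) (hF : ∀ x u, 0 ≤ inner ℝ (F x - F u) (x - u))
    {x : E} (hx : F x = 0) (z : E) : f x ≤ f z := by
  have hd : ∀ t : ℝ, HasDerivAt (fun t : ℝ => f (x + t • (z - x)))
      (inner ℝ (F (x + t • (z - x))) (z - x)) t := by
    intro t
    have h1 : HasDerivAt (fun t : ℝ => x + t • (z - x)) (z - x) t := by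
      simpa using ((hasDerivAt_id t).smul_const (z - x)).const_add x
    have h2 := (hf (x + t • (z - x))).hasFDerivAt.comp_hasDerivAt t h1
    rw [InnerProductSpace.toDual_apply_apply] at h2
    exact h2
  have hmono : MonotoneOn (fun t : ℝ => f (x + t • (z - x))) (Set.Ici 0) := by
    refine monotoneOn_of_deriv_nonneg (convex_Ici 0)
      (fun t _ => (hd t).continuousAt.continuousWithinAt)
      (fun t _ => (hd t).differentiableAt.differentiableWithinAt) fun t ht => ?_
    rw [(hd t).deriv]
    have ht0 : 0 < t := by simpa using ht
    have h := hF (x + t • (z - x)) x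
    rw [hx, sub_zero, add_sub_cancel_left, real_inner_smul_right] at h
    exact nonneg_of_mul_nonneg_right h ht0
  have := hmono (Set.mem_Ici.2 le_rfl) (Set.mem_Ici.2 zero_le_one) zero_le_one
  simpa using this

lemma eq_of_strongly_monotone_of_zero {F : E → E} {m : ℝ} (hm0 : 0 < m)
    (hm : ∀ x u, m * ‖x - u‖ ^ 2 ≤ inner ℝ (F x - F u) (x - u)) {x u : E} (hx : F x = 0)
    (hu : F u = 0) : x = u := by
  have h := hm x u
  rw [hx, hu, sub_zero, inner_zero_left] at h
  have h2 : ‖x - u‖ ^ 2 ≤ 0 := nonpos_of_mul_nonpos_right h hm0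
  exact sub_eq_zero.1 (norm_eq_zero.1 (pow_eq_zero_iff two_ne_zero |>.1
    (le_antisymm h2 (sq_nonneg _))))

end Monotone

section Objectives

variable {n p : ℕ} {f : Fin n → Vec p → ℝ} {L μ : ℝ}

lemma SmoothObjectives.hasGradientAt_sum (h : SmoothObjectives f L) (x : Vec p) :
    HasGradientAt (fun z => ∑ i, f i z) (∑ i, gradient (f i) x) x := by
  rw [hasGradientAt_iff_hasFDerivAt, map_sum]
  exact HasFDerivAt.fun_sum fun i _ =>
    (((h i).1.differentiable one_ne_zero) x).hasGradientAt.hasFDerivAt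

lemma SmoothObjectives.norm_sum_sub_le (h : SmoothObjectives f L) (x u : Vec p) :
    ‖∑ i, gradient (f i) x - ∑ i, gradient (f i) u‖ ≤ n * L * ‖x - u‖ := by
  rw [← Finset.sum_sub_distrib]
  refine (norm_sum_le _ _).trans ((Finset.sum_le_sum fun i _ => (h i).2 x u).trans ?_)
  simp [mul_assoc]

lemma StronglyConvexObjectives.le_inner_sum (h : StronglyConvexObjectives f μ) (x u : Vec p) :
    n * μ * ‖x - u‖ ^ 2 ≤
      inner ℝ (∑ i, gradient (f i) x - ∑ i, gradient (f i) u) (x - u) := by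
  rw [← Finset.sum_sub_distrib, sum_inner]
  refine le_trans ?_ (Finset.sum_le_sum fun i _ => h i x u)
  simp [mul_assoc]

/-- The sum of the objectives has exactly one minimizer, at which the gradients sum to zero. -/
lemma exists_unique_minimizer [NeZero n] (hμ : 0 < μ) (hs : SmoothObjectives f L)
    (hc : StronglyConvexObjectives f μ) :
    ∃ x, ∑ i, gradient (f i) x = 0 ∧ (∀ z, ∑ i, f i x ≤ ∑ i, f i z) ∧
      ∀ w, (∀ z, ∑ i, f i w ≤ ∑ i, f i z) → w = x := by
  have hn : (0 : ℝ) < n := Nat.cast_pos.2 (Nat.pos_of_ne_zero (NeZero.ne n))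
  have hm : 0 < n * μ := by positivity
  obtain ⟨x, hx⟩ := exists_zero_of_strongly_monotone hm hs.norm_sum_sub_le hc.le_inner_sum
  refine ⟨x, hx, isMinOn_of_gradient_eq_zero hs.hasGradientAt_sum
    (fun x u => le_trans (by positivity) (hc.le_inner_sum x u)) hx, fun w hw => ?_⟩
  refine eq_of_strongly_monotone_of_zero hm hc.le_inner_sum ?_ hx
  have h := IsLocalMin.hasFDerivAt_eq_zero (Filter.Eventually.of_forall hw)
    (hs.hasGradientAt_sum w).hasFDerivAt
  exact (map_eq_zero_iff _ (InnerProductSpace.toDual ℝ (Vec p)).injective).1 h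

end Objectives

/-! ### A perturbed recursion driven by decaying weights -/

/-- If `V (k+1) ≤ (1 - c λ_k + M (λ_k - λ_{k+1})) V k + M (λ_k - λ_{k+1})` eventually, where the
weights `λ_k` decay to `0` and have infinite sum, then `V` tends to `0`. -/
lemma DecayingWeights.tendsto_zero_of_recursion {lam : ℕ → ℝ} (hlam : DecayingWeights lam)
    {V : ℕ → ℝ} {c M : ℝ} {k₁ : ℕ} (hk₁ : 1 ≤ k₁) (hc : 0 < c) (hM : 0 ≤ M) (hV : ∀ k, 0 ≤ V k)
    (hrec : ∀ k, k₁ ≤ k → V (k + 1) ≤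
      (1 - c * lam k + M * (lam k - lam (k + 1))) * V k + M * (lam k - lam (k + 1))) :
    Tendsto V atTop (𝓝 0) := by
  -- The `+ 1` turns the additive perturbation into a multiplicative one, and the exponential
  -- absorbs the latter because its exponents telescope. So `U` decreases by at least `c λ_k V k`.
  set U : ℕ → ℝ := fun k => (V k + 1) * Real.exp (M * lam k) with hU
  have hstep : ∀ k, k₁ ≤ k → U (k + 1) ≤ U k - c * lam k * V k := by
    intro k hk
    have hl := hlam.pos k (by omega)
    have hl' := hlam.pos (k + 1) (by omega)
    have hd := hlam.nonincreasing k (by omega)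
    have h1 : V (k + 1) + 1 ≤ (1 + M * (lam k - lam (k + 1))) * (V k + 1) - c * lam k * V k := by
      linarith [hrec k hk]
    have h2 : 1 + M * (lam k - lam (k + 1)) ≤ Real.exp (M * lam k - M * lam (k + 1)) := by
      have := Real.add_one_le_exp (M * lam k - M * lam (k + 1))
      linarith
    have h3 : 1 ≤ Real.exp (M * lam (k + 1)) := Real.one_le_exp (by positivity)
    have h4 : 0 ≤ c * lam k * V k := mul_nonneg (by positivity) (hV k)
    have hV1 : 0 ≤ V k + 1 := by linarith [hV k]
    calc U (k + 1)
        ≤ (Real.exp (M * lam k - M * lam (k + 1)) * (V k + 1) - c * lam k * V k)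
            * Real.exp (M * lam (k + 1)) := by
          refine mul_le_mul_of_nonneg_right (h1.trans ?_) (Real.exp_pos _).le
          exact sub_le_sub_right (mul_le_mul_of_nonneg_right h2 hV1) _
      _ = U k - c * lam k * V k * Real.exp (M * lam (k + 1)) := by
          rw [hU, Real.exp_sub]
          field_simp
      _ ≤ U k - c * lam k * V k := by nlinarith
  have hUpos : ∀ k, 0 ≤ U k := fun k => mul_nonneg (by linarith [hV k]) (Real.exp_pos _).le
  have hanti : Antitone fun j => U (j + k₁) := by
    refine antitone_nat_of_succ_le fun j => ?_
    rw [show j + 1 + k₁ = j + k₁ + 1 by ring]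
    have h := hstep (j + k₁) (by omega)
    have : 0 ≤ c * lam (j + k₁) * V (j + k₁) :=
      mul_nonneg (mul_nonneg hc.le (hlam.pos _ (by omega)).le) (hV _)
    linarith
  obtain ⟨u, hu⟩ : ∃ u, Tendsto U atTop (𝓝 u) := by
    refine ⟨_, (tendsto_add_atTop_iff_nat k₁).1 (tendsto_atTop_ciInf hanti ⟨0, ?_⟩)⟩
    rintro _ ⟨j, rfl⟩
    exact hUpos _
  have hVu : Tendsto V atTop (𝓝 (u - 1)) := by
    have hexp : Tendsto (fun k => Real.exp (M * lam k)) atTop (𝓝 1) := by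
      have := (Real.continuous_exp.tendsto _).comp (hlam.tendsto_zero.const_mul M)
      simpa [Function.comp_def] using this
    have h := (hu.div hexp one_ne_zero).sub_const 1
    rw [div_one] at h
    refine h.congr fun k => ?_
    simp [hU]
  have hv0 : 0 ≤ u - 1 := ge_of_tendsto' hVu hV
  rcases hv0.eq_or_lt with h0 | hpos
  · rwa [← h0] at hVu
  -- With a positive limit, `V` eventually exceeds half of it, and the total decrease of `U` would
  -- bound the partial sums of `lam`.
  exfalso
  obtain ⟨k₂, hk₂⟩ := eventually_atTop.1
    ((hVu.eventually (lt_mem_nhds (half_lt_self hpos))).and (eventually_ge_atTop k₁))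
  have hk₂' := (hk₂ k₂ le_rfl).2
  have hsum : ∀ K, k₂ ≤ K → c * ((u - 1) / 2) * (∑ k ∈ Finset.Icc 1 K, lam k)
      ≤ c * ((u - 1) / 2) * (∑ k ∈ Finset.Icc 1 k₂, lam k) + U (k₂ + 1) - U (K + 1) := by
    intro K hK
    induction K, hK using Nat.le_induction with
    | base => linarith
    | succ K hK ih =>
      rw [Finset.sum_Icc_succ_top (by omega)]
      have h1 := hstep (K + 1) (by omega)
      have h2 := (hk₂ (K + 1) (by omega)).1
      have h3 := hlam.pos (K + 1) (by omega)
      have h4 : c * lam (K + 1) * ((u - 1) / 2) ≤ c * lam (K + 1) * V (K + 1) :=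
        mul_le_mul_of_nonneg_left h2.le (by positivity)
      linarith
  have hT := hlam.sum_eq_top.const_mul_atTop (show 0 < c * ((u - 1) / 2) by positivity)
  obtain ⟨K, hK1, hK2⟩ := ((hT.eventually_gt_atTop
    (c * ((u - 1) / 2) * (∑ k ∈ Finset.Icc 1 k₂, lam k) + U (k₂ + 1))).and
      (eventually_ge_atTop k₂)).exists
  linarith [hsum K hK2, hUpos (K + 1)]

/-- Coupled recursions for an optimality gap `D`, a consensus error `C` and a tracking error `R`. -/
lemma DecayingWeights.tendsto_zero_of_coupled_recursion {lam : ℕ → ℝ} (hlam : DecayingWeights lam)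
    {D C R : ℕ → ℝ} {c γ K : ℝ} {k₁ : ℕ} (hk₁ : 1 ≤ k₁) (hc : 0 < c) (hγ : γ < 1) (hK : 0 < K)
    (hD0 : ∀ k, 0 ≤ D k) (hC0 : ∀ k, 0 ≤ C k) (hR0 : ∀ k, 0 ≤ R k)
    (hD : ∀ k, k₁ ≤ k → D (k + 1) ≤ (1 - c * lam k) * D k + K * (lam k * C k + R k))
    (hC : ∀ k, k₁ ≤ k → C (k + 1) ≤ γ * C k + K * (lam k * C k + lam k * D k + R k))
    (hR : ∀ k, k₁ ≤ k → R (k + 1) ≤ γ * R k + K * lam k * (C k + R k + lam k * D k)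
      + K * (lam k - lam (k + 1)) * (1 + C k + D k)) :
    Tendsto D atTop (𝓝 0) ∧ Tendsto C atTop (𝓝 0) := by
  have hg : 0 < 1 - γ := by linarith
  -- Weights of `V = D + s C + q R`: with this `s`, the feedback of `D` through `C` costs a quarter
  -- of the decay `c λ_k`; `q` makes the decay of `R` worth twice its contribution `K (1 + s)` to
  -- `D` and `s C`.
  set s := c / (4 * K) with hs
  have hs0 : 0 < s := by positivity
  have hsK : s * K = c / 4 := by rw [hs]; field_simp
  set q := 2 * K * (1 + s) / (1 - γ) with hq
  have hq0 : 0 < q := by positivity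
  have hqK : q * (1 - γ) = 2 * (K * (1 + s)) := by rw [hq]; field_simp
  have hqK0 : 0 < q * K := by positivity
  have small : ∀ a b : ℝ, 0 < b → ∀ᶠ k in atTop, a * lam k < b := by
    intro a b hb
    have h := hlam.tendsto_zero.const_mul a
    rw [mul_zero] at h
    exact h.eventually (gt_mem_nhds hb)
  -- The three smallness conditions serve the coefficients of `D`, `C` and `R` in turn, in `cD`,
  -- `cC` and `cR`.
  obtain ⟨k₂, hk₂⟩ := eventually_atTop.1 ((small (q * K) (c / 4) (by positivity)).and
    ((small (K + s * K + 2 * (q * K) + s * c) (s * (1 - γ)) (by positivity)).and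
      ((small (q * K + q * c) (K * (1 + s)) (by positivity)).and (eventually_ge_atTop k₁))))
  have hV : Tendsto (fun k => D k + s * C k + q * R k) atTop (𝓝 0) := by
    refine hlam.tendsto_zero_of_recursion (c := c / 2) (M := q * K) (k₁ := max k₂ k₁)
      (hk₁.trans (le_max_right _ _)) (by positivity) hqK0.le
      (fun k => add_nonneg (add_nonneg (hD0 k) (mul_nonneg hs0.le (hC0 k)))
        (mul_nonneg hq0.le (hR0 k))) fun k hk => ?_
    obtain ⟨h1, h2, h3, h4⟩ := hk₂ k ((le_max_left _ _).trans hk)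
    have hl := hlam.pos k (by omega)
    have hl' := hlam.pos (k + 1) (by omega)
    have hd := hlam.nonincreasing k (by omega)
    set l := lam k
    set δ := l - lam (k + 1) with hδ
    have hδ0 : 0 ≤ δ := by linarith
    have hδl : δ ≤ l := by linarith
    have hDk := hD0 k
    have hCk := hC0 k
    have hRk := hR0 k
    have eD := hD k h4
    have eC := mul_le_mul_of_nonneg_left (hC k h4) hs0.le
    have eR := mul_le_mul_of_nonneg_left (hR k h4) hq0.le
    have cD : 1 - c * l + s * K * l + q * K * l * l ≤ 1 - c / 2 * l := by
      have := mul_le_mul_of_nonneg_right h1.le hl.le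
      rw [hsK]
      linarith
    have cC : K * l + s * γ + s * K * l + q * K * l + q * K * δ ≤ s * (1 - c / 2 * l) := by
      have e1 := mul_le_mul_of_nonneg_left hδl hqK0.le
      have e2 : 0 ≤ s * c * l := by positivity
      linarith
    have cR : K + s * K + q * γ + q * K * l ≤ q * (1 - c / 2 * l) := by
      have e2 : 0 ≤ q * c * l := by positivity
      linarith
    have mD := mul_le_mul_of_nonneg_right cD hDk
    have mC := mul_le_mul_of_nonneg_right cC hCk
    have mR := mul_le_mul_of_nonneg_right cR hRk
    -- The drift term in `D` is completed to a multiple of `V`; the one in `C` was already absorbed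
    -- in `cC` through `δ ≤ l`.
    have r1 : 0 ≤ q * K * δ * (s * C k) := by positivity
    have r2 : 0 ≤ q * K * δ * (q * R k) := by positivity
    linarith
  have hD' : Tendsto D atTop (𝓝 0) := squeeze_zero hD0
    (fun k => by nlinarith [mul_nonneg hs0.le (hC0 k), mul_nonneg hq0.le (hR0 k)]) hV
  refine ⟨hD', ?_⟩
  have hC' : Tendsto (fun k => s⁻¹ * (D k + s * C k + q * R k)) atTop (𝓝 0) := by
    simpa using hV.const_mul s⁻¹
  refine squeeze_zero hC0 (fun k => ?_) hC'
  rw [le_inv_mul_iff₀ hs0]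
  linarith [hD0 k, mul_nonneg hq0.le (hR0 k)]

/-! ### The weighted gradient-tracking iteration -/

section Trajectory

variable {n p : ℕ} {f : Fin n → Vec p → ℝ} {A B : ℕ → Matrix (Fin n) (Fin n) ℝ} {α : Fin n → ℝ}
  {lam : ℕ → ℝ} {x y : ℕ → Fin n → Vec p} {φ : ℕ → Fin n → ℝ}

/-- The `φ_k`-weighted average of the agents' states. -/
def weightedMean (φ : ℕ → Fin n → ℝ) (x : ℕ → Fin n → Vec p) (k : ℕ) : Vec p :=
  ∑ i, φ k i • x k i

/-- The sum of the local gradients at the agents' states. -/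
def gradSum (f : Fin n → Vec p → ℝ) (x : ℕ → Fin n → Vec p) (k : ℕ) : Vec p :=
  ∑ i, gradient (f i) (x k i)

/-- The deviation of the trackers `y_k` from `π_k` times their sum. -/
def trackingError (f : Fin n → Vec p → ℝ) (B : ℕ → Matrix (Fin n) (Fin n) ℝ) (lam : ℕ → ℝ)
    (x y : ℕ → Fin n → Vec p) (k : ℕ) (i : Fin n) : Vec p :=
  y k i - piSeq B k i • lam k • gradSum f x k

/-- Column-stochastic mixing preserves the sum, and the gradient increments telescope. -/
lemma IsTrajectory.sum_y (h : IsTrajectory f A B α lam x y)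
    (hB : ∀ k, B (k + 1) ∈ colStochastic ℝ (Fin n)) {k : ℕ} (hk : 1 ≤ k) :
    ∑ i, y k i = lam k • gradSum f x k := by
  induction k, hk using Nat.le_induction with
  | base => simp only [h.y_init, gradSum, Finset.smul_sum]
  | succ k hk ih =>
    obtain ⟨q, rfl⟩ : ∃ q, k = q + 1 := ⟨k - 1, by omega⟩
    simp only [h.y_step _ hk, Finset.sum_sub_distrib, Finset.sum_add_distrib]
    rw [Finset.sum_comm]
    simp only [← Finset.sum_smul, sum_col_of_mem_colStochastic (hB q), one_smul, ih, gradSum,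
      Finset.smul_sum]
    abel

lemma IsTrajectory.weightedMean_succ_eq (h : IsTrajectory f A B α lam x y)
    (hφ : IsAbsoluteProbabilitySequence A φ) {k : ℕ} (hk : 1 ≤ k) :
    weightedMean φ x (k + 1) = ∑ j, φ k j • (x k j - α j • y k j) := by
  simp only [weightedMean, h.x_step k hk, Finset.smul_sum, smul_smul]
  rw [Finset.sum_comm]
  refine Finset.sum_congr rfl fun j _ => ?_
  rw [← Finset.sum_smul, ← hφ.step k hk]
  rfl

lemma IsTrajectory.weightedMean_succ (h : IsTrajectory f A B α lam x y)
    (hφ : IsAbsoluteProbabilitySequence A φ) {k : ℕ} (hk : 1 ≤ k) :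
    weightedMean φ x (k + 1) = weightedMean φ x k - ∑ j, (φ k j * α j) • y k j := by
  rw [h.weightedMean_succ_eq hφ hk]
  simp only [smul_sub, Finset.sum_sub_distrib, smul_smul, weightedMean]

/-- The rows of `A k - 𝟏 (φ k)ᵀ` sum to zero, so the mean may be subtracted inside the sum. -/
lemma IsTrajectory.deviation_succ (h : IsTrajectory f A B α lam x y)
    (hφ : IsAbsoluteProbabilitySequence A φ) {k : ℕ} (hk : 1 ≤ k)
    (hA : ∀ i, ∑ j, A k i j = 1) (i : Fin n) :
    x (k + 1) i - weightedMean φ x (k + 1) =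
      ∑ j, (A k - vecMulVec (fun _ => 1) (φ k) : Matrix (Fin n) (Fin n) ℝ) i j •
        ((x k j - weightedMean φ x k) - α j • y k j) := by
  have h0 : ∑ j, (A k - vecMulVec (fun _ => 1) (φ k) : Matrix (Fin n) (Fin n) ℝ) i j = 0 := by
    simp [vecMulVec_apply, Finset.sum_sub_distrib, hA, hφ.sum_eq_one k hk]
  have h1 : ∀ j, (x k j - weightedMean φ x k) - α j • y k j
      = (x k j - α j • y k j) - weightedMean φ x k := fun j => by abel
  simp only [h1, smul_sub (_ : ℝ) (x k _ - α _ • y k _)]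
  rw [Finset.sum_sub_distrib, ← Finset.sum_smul, h0, zero_smul, sub_zero,
    h.weightedMean_succ_eq hφ hk, h.x_step k hk, ← Finset.sum_sub_distrib]
  refine Finset.sum_congr rfl fun j _ => ?_
  rw [← sub_smul]
  simp [vecMulVec_apply]

lemma IsTrajectory.sum_trackingError (h : IsTrajectory f A B α lam x y)
    (hB : ∀ k, B (k + 1) ∈ colStochastic ℝ (Fin n)) [NeZero n] {k : ℕ} (hk : 1 ≤ k) :
    ∑ i, trackingError f B lam x y k i = 0 := by
  obtain ⟨q, rfl⟩ : ∃ q, k = q + 1 := ⟨k - 1, by omega⟩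
  simp only [trackingError, Finset.sum_sub_distrib, ← Finset.sum_smul, h.sum_y hB hk,
    (piSeq_mem_stdSimplex hB q).2, one_smul, sub_self]

/-- Tracking errors sum to zero, so `π_k 𝟏ᵀ` may be removed from `B k`; the relation `π_{k+1} = B_k
π_k` matches the reference vectors. -/
lemma IsTrajectory.trackingError_succ (h : IsTrajectory f A B α lam x y)
    (hB : ∀ k, B (k + 1) ∈ colStochastic ℝ (Fin n)) [NeZero n] {k : ℕ} (hk : 1 ≤ k) (i : Fin n) :
    trackingError f B lam x y (k + 1) i =
      ∑ j, (B k - vecMulVec (piSeq B k) fun _ => 1 : Matrix (Fin n) (Fin n) ℝ) i j • trackingError f B lam x y k j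
        + ((lam (k + 1) • gradient (f i) (x (k + 1) i) - lam k • gradient (f i) (x k i))
          - piSeq B (k + 1) i • ∑ l,
            (lam (k + 1) • gradient (f l) (x (k + 1) l) - lam k • gradient (f l) (x k l))) := by
  have h0 := h.sum_trackingError hB hk
  have h1 : ∑ j, (B k - vecMulVec (piSeq B k) fun _ => 1 : Matrix (Fin n) (Fin n) ℝ) i j • trackingError f B lam x y k j
      = ∑ j, B k i j • trackingError f B lam x y k j := by
    simp only [Matrix.sub_apply, vecMulVec_apply, mul_one, sub_smul, Finset.sum_sub_distrib,
      ← Finset.smul_sum, h0, smul_zero, sub_zero]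
  have h2 : piSeq B (k + 1) i = ∑ j, B k i j * piSeq B k j := by
    obtain ⟨q, rfl⟩ : ∃ q, k = q + 1 := ⟨k - 1, by omega⟩
    rfl
  have h3 : ∑ j, B k i j • trackingError f B lam x y k j
      = ∑ j, B k i j • y k j - piSeq B (k + 1) i • lam k • gradSum f x k := by
    rw [h2]
    simp only [trackingError, smul_sub, Finset.sum_sub_distrib, smul_smul, ← Finset.sum_smul,
      Finset.sum_mul, mul_assoc]
  rw [h1, h3, Finset.sum_sub_distrib, ← Finset.smul_sum, ← Finset.smul_sum, trackingError,
    h.y_step k hk]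
  simp only [gradSum, smul_sub]
  abel

end Trajectory

/-! ### Error recursions and convergence of the iterates -/

lemma norm_sum_smul_le_of_mem_stdSimplex {n p : ℕ} {v : Fin n → ℝ} (hv : v ∈ stdSimplex ℝ (Fin n))
    {α : Fin n → ℝ} (hα : ∀ i, 0 ≤ α i) {z : Fin n → Vec p} {c : ℝ} (hz : ∀ i, ‖z i‖ ≤ c) :
    ‖∑ i, (v i * α i) • z i‖ ≤ (∑ i, α i) * c := by
  calc ‖∑ i, (v i * α i) • z i‖ ≤ ∑ i, v i * ((∑ i, α i) * c) := by
        refine norm_sum_le_of_le _ fun i _ => ?_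
        rw [norm_smul, Real.norm_of_nonneg (mul_nonneg (hv.1 i) (hα i)), mul_assoc]
        refine mul_le_mul_of_nonneg_left ?_ (hv.1 i)
        exact mul_le_mul (Finset.single_le_sum (fun i _ => hα i) (Finset.mem_univ i)) (hz i)
          (norm_nonneg _) (Finset.sum_nonneg fun i _ => hα i)
    _ = _ := by rw [← Finset.sum_mul, hv.2, one_mul]

/-- With decaying weights and at least one positive step size, the iterates of every agent
converge to the point at which the gradients sum to zero. Since the weights tend to `0`, the
effective step sizes are eventually as small as needed, so no upper bound on `α` is required. -/
lemma IsTrajectory.tendsto {n p : ℕ} [NeZero n] {f : Fin n → Vec p → ℝ} {L μ : ℝ} (hL : 0 < L)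
    (hμ : 0 < μ) (hs : SmoothObjectives f L) (hc : StronglyConvexObjectives f μ)
    {G : Digraph (Fin n)} (hG : StronglyConnected G) {A B : ℕ → Matrix (Fin n) (Fin n) ℝ}
    (hA : RowStochasticCompatible G A) (hB : ColStochasticCompatible G B) {lam : ℕ → ℝ}
    (hlam : DecayingWeights lam) {φ : ℕ → Fin n → ℝ} (hφ : IsAbsoluteProbabilitySequence A φ)
    {α : Fin n → ℝ} (hα : ∀ i, 0 ≤ α i) {i₀ : Fin n} (hi₀ : 0 < α i₀)
    {x y : ℕ → Fin n → Vec p} (h : IsTrajectory f A B α lam x y) {z : Vec p}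
    (hz : ∑ i, gradient (f i) z = 0) (i : Fin n) :
    Tendsto (fun k => x k i) atTop (𝓝 z) := by
  have hn : (0 : ℝ) < n := Nat.cast_pos.2 (Nat.pos_of_ne_zero (NeZero.ne n))
  obtain ⟨a, ha, hQA⟩ := hA.exists_uniformlyCompatible
  obtain ⟨b, hb, hQB⟩ := hB.exists_uniformlyCompatible
  obtain ⟨NA, γA, hγA0, hγA1, hNA, hcA⟩ := exists_contracted_seminorm_of_row hG hA hφ
  obtain ⟨NB, γB, hγB0, hγB1, hNB, hcB⟩ := exists_contracted_seminorm_of_col hG hB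
  obtain ⟨KA, hKA0, hKA⟩ := exists_stackedSeminorm_le p NA
  obtain ⟨KB, hKB0, hKB⟩ := exists_stackedSeminorm_le p NB
  obtain ⟨εφ, hεφ, hφε⟩ := hQA.exists_le_of_backward ha hG.swap hφ.mem_stdSimplex fun k => by
    rw [Matrix.mulVec_transpose]
    exact (hφ.step (k + 1) k.succ_pos).symm
  obtain ⟨επ, hεπ, m, hπε⟩ := hQB.exists_eventually_le_of_forward hb hG
    (piSeq_mem_stdSimplex hQB.mem) fun k => rfl
  set X : ℕ → Fin n → Vec p := fun k i => x k i - weightedMean φ x k with hX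
  set D : ℕ → ℝ := fun k => ‖weightedMean φ x k - z‖ with hD
  set C : ℕ → ℝ := fun k => stackedSeminorm NA (X k) with hC
  set R : ℕ → ℝ := fun k => stackedSeminorm NB (trackingError f B lam x y k) with hR
  have hD0 : ∀ k, 0 ≤ D k := fun k => norm_nonneg _
  have hC0 : ∀ k, 0 ≤ C k := fun k => apply_nonneg _ _
  have hR0 : ∀ k, 0 ≤ R k := fun k => apply_nonneg _ _
  have hxC : ∀ k i, ‖x k i - weightedMean φ x k‖ ≤ C k := fun k i =>
    (norm_le_pi_norm (X k) i).trans (norm_le_stackedSeminorm hNA _)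
  have hrR : ∀ k i, ‖trackingError f B lam x y k i‖ ≤ R k := fun k i =>
    (norm_le_pi_norm (trackingError f B lam x y k) i).trans (norm_le_stackedSeminorm hNB _)
  have hxz : ∀ k i, ‖x k i - z‖ ≤ C k + D k := fun k i => by
    rw [← sub_add_sub_cancel (x k i) (weightedMean φ x k) z]
    exact norm_add_le_of_le (hxC k i) le_rfl
  set s := ∑ i, α i with hs_def
  have hαs : ∀ i, α i ≤ s := fun i => Finset.single_le_sum (fun i _ => hα i) (Finset.mem_univ i)
  have hs0 : 0 < s := hi₀.trans_le (hαs i₀)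
  set Λ := n * L with hΛ
  have hΛ0 : 0 < Λ := by positivity
  set g := ∑ i, ‖gradient (f i) z‖ with hg
  have hg0 : 0 ≤ g := Finset.sum_nonneg fun _ _ => norm_nonneg _
  set H := KB * (1 + n) with hH
  have hH0 : 0 ≤ H := by positivity
  -- The lower bound for `∑ φ_j α_j π_j` from agent `i₀` alone, times the monotonicity constant; the
  -- half comes from `norm_gradient_step_sub_le`.
  set c := εφ * α i₀ * επ * (n * μ) / 2 with hc_def
  have hc0 : 0 < c := by positivity
  set Y : ℕ → ℝ := fun k => lam k * (Λ * (C k + D k)) + R k with hY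
  have hgrad : ∀ k, ‖gradSum f x k - ∑ i, gradient (f i) (weightedMean φ x k)‖ ≤ Λ * C k := by
    intro k
    rw [gradSum, ← Finset.sum_sub_distrib]
    refine (norm_sum_le_of_le (n := fun _ => L * C k) _ fun i _ => ((hs i).2 _ _).trans
      (mul_le_mul_of_nonneg_left (hxC k i) hL.le)).trans ?_
    simp [hΛ, mul_assoc]
  have hgrad' : ∀ k, ‖gradSum f x k‖ ≤ Λ * (C k + D k) := by
    intro k
    have h1 := hs.norm_sum_sub_le (weightedMean φ x k) z
    rw [hz, sub_zero] at h1
    have h2 := norm_add_le_of_le (hgrad k) h1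
    rw [sub_add_cancel] at h2
    linarith
  have hπ1 : ∀ k, 1 ≤ k → ∀ i, 0 ≤ piSeq B k i ∧ piSeq B k i ≤ 1 := by
    intro k hk i
    obtain ⟨q, rfl⟩ : ∃ q, k = q + 1 := ⟨k - 1, by omega⟩
    have hπ := piSeq_mem_stdSimplex hQB.mem q
    exact ⟨hπ.1 i, hπ.2 ▸ Finset.single_le_sum (fun i _ => hπ.1 i) (Finset.mem_univ i)⟩
  have hφs : ∀ k, 1 ≤ k → φ k ∈ stdSimplex ℝ (Fin n) := fun k hk =>
    ⟨hφ.nonneg k hk, hφ.sum_eq_one k hk⟩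
  have hy : ∀ k, 1 ≤ k → ∀ i, ‖y k i‖ ≤ Y k := by
    intro k hk i
    have hl := hlam.pos k hk
    have h1 : y k i = piSeq B k i • lam k • gradSum f x k + trackingError f B lam x y k i := by
      rw [trackingError]; abel
    rw [h1]
    refine norm_add_le_of_le ?_ (hrR k i)
    rw [norm_smul, norm_smul, Real.norm_of_nonneg (hπ1 k hk i).1, Real.norm_of_nonneg hl.le]
    calc _ ≤ 1 * (lam k * (Λ * (C k + D k))) :=
          mul_le_mul (hπ1 k hk i).2 (mul_le_mul_of_nonneg_left (hgrad' k) hl.le)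
            (mul_nonneg hl.le (norm_nonneg _)) zero_le_one
      _ = _ := one_mul _
  have hmove : ∀ k, 1 ≤ k → ‖weightedMean φ x (k + 1) - weightedMean φ x k‖ ≤ s * Y k := by
    intro k hk
    rw [h.weightedMean_succ hφ hk, sub_sub_cancel_left, norm_neg]
    exact norm_sum_smul_le_of_mem_stdSimplex (hφs k hk) hα (hy k hk)
  have hCstep : ∀ k, 1 ≤ k → C (k + 1) ≤ γA * C k + KA * (s * Y k) := by
    intro k hk
    have hX' : X (k + 1) = fun i => ∑ j, (A k - vecMulVec (fun _ => 1) (φ k) : Matrix (Fin n) (Fin n) ℝ) i j •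
        (X k - fun j => α j • y k j) j := by
      ext1 i
      obtain ⟨q, rfl⟩ : ∃ q, k = q + 1 := ⟨k - 1, by omega⟩
      exact h.deviation_succ hφ hk (sum_col_of_mem_colStochastic (hQA.mem q)) i
    have hY0 : 0 ≤ Y k := (norm_nonneg _).trans (hy k hk i)
    have h1 : stackedSeminorm NA (fun j => α j • y k j) ≤ KA * (s * Y k) := by
      refine (hKA _).trans (mul_le_mul_of_nonneg_left ?_ hKA0)
      refine (pi_norm_le_iff_of_nonneg (by positivity)).2 fun j => ?_
      rw [norm_smul, Real.norm_of_nonneg (hα j)]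
      exact mul_le_mul (hαs j) (hy k hk j) (norm_nonneg _) hs0.le
    have h2 : C (k + 1) ≤ γA * stackedSeminorm NA (X k - fun j => α j • y k j) := by
      simp only [hC]
      rw [hX']
      exact stackedSeminorm_mulVec_le (hcA k hk) _
    have h3 : stackedSeminorm NA (X k - fun j => α j • y k j) ≤ C k + KA * (s * Y k) :=
      (map_sub_le_add _ _ _).trans (add_le_add_right h1 _)
    have h4 : 0 ≤ KA * (s * Y k) := by positivity
    nlinarith [mul_le_mul_of_nonneg_left h3 hγA0.le]
  have hRstep : ∀ k, 1 ≤ k → R (k + 1) ≤ γB * R k +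
      H * (lam k * (L * (C (k + 1) + s * Y k + C k))
        + (lam k - lam (k + 1)) * (g + L * (C k + D k))) := by
    intro k hk
    have hl := hlam.pos k hk
    have hl' := hlam.pos (k + 1) (by omega)
    have hd := hlam.nonincreasing k hk
    set d : Fin n → Vec p := fun i =>
      lam (k + 1) • gradient (f i) (x (k + 1) i) - lam k • gradient (f i) (x k i) with hd_def
    set δ := lam k * (L * (C (k + 1) + s * Y k + C k))
      + (lam k - lam (k + 1)) * (g + L * (C k + D k)) with hδ
    have hdδ : ∀ i, ‖d i‖ ≤ δ := by
      intro i
      -- The first part is controlled by the movement of the states. The second persists even at the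
      -- minimizer, but carries the summable factor `λ_k - λ_{k+1}`.
      have h1 : d i = lam (k + 1) • (gradient (f i) (x (k + 1) i) - gradient (f i) (x k i))
          + (-(lam k - lam (k + 1))) • gradient (f i) (x k i) := by
        simp only [hd_def, smul_sub, neg_smul, sub_smul]
        abel
      have h2 : ‖x (k + 1) i - x k i‖ ≤ C (k + 1) + s * Y k + C k := by
        have e : x (k + 1) i - x k i = (x (k + 1) i - weightedMean φ x (k + 1))
            + (weightedMean φ x (k + 1) - weightedMean φ x k)
            + (weightedMean φ x k - x k i) := by abel
        rw [e]
        refine norm_add_le_of_le (norm_add_le_of_le (hxC _ i) (hmove k hk)) ?_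
        rw [norm_sub_rev]
        exact hxC k i
      have h3 : ‖gradient (f i) (x k i)‖ ≤ g + L * (C k + D k) := by
        have e : gradient (f i) (x k i) = gradient (f i) z
            + (gradient (f i) (x k i) - gradient (f i) z) := by abel
        rw [e]
        refine norm_add_le_of_le ?_
          (((hs i).2 _ _).trans (mul_le_mul_of_nonneg_left (hxz k i) hL.le))
        exact Finset.single_le_sum (f := fun i => ‖gradient (f i) z‖)
          (fun _ _ => norm_nonneg _) (Finset.mem_univ i)
      rw [h1]
      refine norm_add_le_of_le ?_ ?_
      · rw [norm_smul, Real.norm_of_nonneg hl'.le]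
        exact mul_le_mul hd (((hs i).2 _ _).trans (mul_le_mul_of_nonneg_left h2 hL.le))
          (norm_nonneg _) hl.le
      · rw [norm_smul, norm_neg, Real.norm_of_nonneg (by linarith)]
        exact mul_le_mul_of_nonneg_left h3 (by linarith)
    have hδ0 : 0 ≤ δ := (norm_nonneg _).trans (hdδ i)
    have hr : trackingError f B lam x y (k + 1) =
        (fun i => ∑ j, (B k - vecMulVec (piSeq B k) fun _ => 1 : Matrix (Fin n) (Fin n) ℝ) i j •
          trackingError f B lam x y k j) + fun i => d i - piSeq B (k + 1) i • ∑ l, d l := by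
      ext1 i
      exact h.trackingError_succ hQB.mem hk i
    have h1 : stackedSeminorm NB (fun i => d i - piSeq B (k + 1) i • ∑ l, d l) ≤ H * δ := by
      rw [hH, mul_assoc]
      refine (hKB _).trans (mul_le_mul_of_nonneg_left ?_ hKB0)
      refine (pi_norm_le_iff_of_nonneg (by positivity)).2 fun j => ?_
      have hsum : ‖∑ l, d l‖ ≤ n * δ := by
        refine (norm_sum_le_of_le (n := fun _ => δ) _ fun l _ => hdδ l).trans ?_
        simp
      have hπ := hπ1 (k + 1) (by omega) j
      have e : ‖piSeq B (k + 1) j • ∑ l, d l‖ ≤ n * δ := by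
        rw [norm_smul, Real.norm_of_nonneg hπ.1]
        exact (mul_le_of_le_one_left (norm_nonneg _) hπ.2).trans hsum
      exact (norm_sub_le_of_le (hdδ j) e).trans (le_of_eq (by ring))
    simp only [hR]
    rw [hr]
    exact (map_add_le_add _ _ _).trans
      (add_le_add (stackedSeminorm_mulVec_le (hcB k hk) _) h1)
  have hDstep : ∀ k, 1 ≤ k → m + 1 ≤ k → s * Λ ^ 2 * lam k ≤ n * μ → s * (n * μ) * lam k ≤ 1 →
      D (k + 1) ≤ (1 - c * lam k) * D k + (lam k * (s * Λ * C k) + s * R k) := by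
    intro k hk hmk hk1 hk2
    have hl := hlam.pos k hk
    set θ := ∑ j, φ k j * α j * piSeq B k j with hθ
    have hθs : θ ≤ s := by
      calc θ ≤ ∑ j, φ k j * s := Finset.sum_le_sum fun j _ => by
            rw [mul_assoc]
            refine mul_le_mul_of_nonneg_left ?_ (hφ.nonneg k hk j)
            exact (mul_le_of_le_one_right (hα j) (hπ1 k hk j).2).trans (hαs j)
        _ = s := by rw [← Finset.sum_mul, hφ.sum_eq_one k hk, one_mul]
    have hθε : εφ * α i₀ * επ ≤ θ := by
      obtain ⟨q, rfl⟩ : ∃ q, k = q + 1 := ⟨k - 1, by omega⟩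
      refine le_trans ?_ (Finset.single_le_sum
        (f := fun j => φ (q + 1) j * α j * piSeq B (q + 1) j)
        (fun j _ => mul_nonneg (mul_nonneg (hφ.nonneg _ hk j) (hα j)) (hπ1 _ hk j).1)
        (Finset.mem_univ i₀))
      exact mul_le_mul (mul_le_mul_of_nonneg_right (hφε q i₀) hi₀.le)
        (hπε q (by omega) i₀) hεπ.le (mul_nonneg (hφ.nonneg _ hk _) hi₀.le)
    have hθ0 : 0 ≤ θ := le_trans (by positivity) hθε
    have hη0 : 0 ≤ lam k * θ := by positivity
    set F : Vec p → Vec p := fun w => ∑ i, gradient (f i) w with hF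
    have hFz : F z = 0 := hz
    -- An exact gradient step compared with its fixed point `z`, then the consensus error in the
    -- gradients, then the tracking error.
    have e : weightedMean φ x (k + 1) - z
        = ((weightedMean φ x k - (lam k * θ) • F (weightedMean φ x k)) - (z - (lam k * θ) • F z))
          - (lam k * θ) • (gradSum f x k - F (weightedMean φ x k))
          - ∑ j, (φ k j * α j) • trackingError f B lam x y k j := by
      have e1 : ∑ j, (φ k j * α j) • y k j = (lam k * θ) • gradSum f x k
          + ∑ j, (φ k j * α j) • trackingError f B lam x y k j := by
        have : (lam k * θ) • gradSum f x k
            = ∑ j, (φ k j * α j) • piSeq B k j • lam k • gradSum f x k := by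
          rw [mul_comm, hθ]
          simp only [smul_smul, ← Finset.sum_smul, Finset.sum_mul, mul_assoc]
        rw [this, ← Finset.sum_add_distrib]
        refine Finset.sum_congr rfl fun j _ => ?_
        rw [← smul_add, trackingError, add_sub_cancel]
      rw [h.weightedMean_succ hφ hk, e1, hFz, smul_sub]
      simp only [smul_zero, sub_zero]
      abel
    have hη1 : lam k * θ * Λ ^ 2 ≤ n * μ := by
      have := mul_le_mul_of_nonneg_left hθs (mul_nonneg hl.le (sq_nonneg Λ))
      linarith
    have hη2 : lam k * θ * (n * μ) ≤ 1 := by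
      have := mul_le_mul_of_nonneg_left hθs (mul_nonneg hl.le (mul_pos hn hμ).le)
      linarith
    have b1 := norm_gradient_step_sub_le (F := F) (η := lam k * θ) hs.norm_sum_sub_le
      hc.le_inner_sum hη0 hη1 hη2 (weightedMean φ x k) z
    have b2 : ‖(lam k * θ) • (gradSum f x k - F (weightedMean φ x k))‖
        ≤ lam k * (s * Λ * C k) := by
      rw [norm_smul, Real.norm_of_nonneg hη0, mul_assoc, mul_assoc]
      exact mul_le_mul_of_nonneg_left
        (mul_le_mul hθs (hgrad k) (norm_nonneg _) hs0.le) hl.le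
    have b3 := norm_sum_smul_le_of_mem_stdSimplex (hφs k hk) hα (hrR k)
    have b4 : (1 - lam k * θ * (n * μ) / 2) * D k ≤ (1 - c * lam k) * D k := by
      refine mul_le_mul_of_nonneg_right ?_ (hD0 k)
      have := mul_le_mul_of_nonneg_left hθε (mul_nonneg hl.le (mul_pos hn hμ).le)
      rw [hc_def]
      linarith
    have b5 := norm_sub_le_of_le (norm_sub_le_of_le b1 b2) b3
    rw [← e] at b5
    simp only [hD] at b4 ⊢
    linarith
  -- one constant dominating all the coefficients above
  obtain ⟨K, hK0, K1, K2, K3, K4, K5, K6, K7, K8⟩ : ∃ K : ℝ, 0 < K ∧ s * Λ ≤ K ∧ s ≤ K ∧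
      KA * s * Λ ≤ K ∧ KA * s ≤ K ∧ H * L * (2 + (KA + 1) * s * Λ) ≤ K ∧
      H * L * ((KA + 1) * s) ≤ K ∧ H * g ≤ K ∧ H * L ≤ K := by
    have p1 : 0 < s * Λ := by positivity
    have p3 : 0 ≤ KA * s * Λ := by positivity
    have p4 : 0 ≤ KA * s := by positivity
    have p5 : 0 ≤ H * L * (2 + (KA + 1) * s * Λ) := by positivity
    have p6 : 0 ≤ H * L * ((KA + 1) * s) := by positivity
    have p7 : 0 ≤ H * g := by positivity
    have p8 : 0 ≤ H * L := by positivity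
    refine ⟨s * Λ + s + KA * s * Λ + KA * s + H * L * (2 + (KA + 1) * s * Λ)
      + H * L * ((KA + 1) * s) + H * g + H * L, ?_, ?_, ?_, ?_, ?_, ?_, ?_, ?_, ?_⟩ <;> linarith
  have small : ∀ a b : ℝ, 0 < b → ∀ᶠ k in atTop, a * lam k ≤ b := by
    intro a b hb
    have h := hlam.tendsto_zero.const_mul a
    rw [mul_zero] at h
    exact h.eventually (ge_mem_nhds hb)
  obtain ⟨k₁, hk₁⟩ := eventually_atTop.1 ((small (s * Λ ^ 2) (n * μ) (by positivity)).and
    ((small (s * (n * μ)) 1 one_pos).and ((small 1 1 one_pos).and (eventually_ge_atTop (m + 1)))))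
  have hlim := hlam.tendsto_zero_of_coupled_recursion (D := D) (C := C) (R := R)
    (γ := max γA γB) (k₁ := k₁ + 1) (by omega) hc0 (max_lt hγA1 hγB1) hK0 hD0 hC0 hR0
    (by
      intro k hk
      obtain ⟨q1, q2, -, q4⟩ := hk₁ k (by omega)
      have hl := hlam.pos k (by omega)
      refine (hDstep k (by omega) q4 q1 q2).trans ?_
      have e1 := mul_le_mul_of_nonneg_right K1 (mul_nonneg hl.le (hC0 k))
      have e2 := mul_le_mul_of_nonneg_right K2 (hR0 k)
      linarith)
    (by
      intro k hk
      have hl := hlam.pos k (by omega)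
      refine (hCstep k (by omega)).trans ?_
      have e0 := mul_le_mul_of_nonneg_right (le_max_left γA γB) (hC0 k)
      have e1 := mul_le_mul_of_nonneg_right K3 (mul_nonneg hl.le (add_nonneg (hC0 k) (hD0 k)))
      have e2 := mul_le_mul_of_nonneg_right K4 (hR0 k)
      simp only [hY]
      linarith)
    (by
      intro k hk
      obtain ⟨-, -, q3, -⟩ := hk₁ k (by omega)
      have hl := hlam.pos k (by omega)
      have hd := hlam.nonincreasing k (by omega)
      have hCD : 0 ≤ C k + D k := add_nonneg (hC0 k) (hD0 k)
      have hCk := hC0 k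
      have hDk := hD0 k
      have hRk := hR0 k
      refine (hRstep k (by omega)).trans ?_
      have e0 := mul_le_mul_of_nonneg_right (le_max_right γA γB) (hR0 k)
      -- The states move by an amount in which `D` appears only with a factor `λ_k`; with the outer
      -- `λ_k` this gives the `λ_k² D` that the coupled recursion requires.
      have e1 : C (k + 1) + s * Y k + C k ≤
          (2 + (KA + 1) * s * Λ) * (C k + lam k * D k) + (KA + 1) * s * R k := by
        have t1 := hCstep k (by omega)
        have t2 : γA * C k ≤ C k := mul_le_of_le_one_left hCk hγA1.le
        have t3 : 0 ≤ 2 * (lam k * D k) := by positivity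
        have t4 : (KA + 1) * s * Λ * (lam k * C k) ≤ (KA + 1) * s * Λ * C k := by
          refine mul_le_mul_of_nonneg_left ?_ (by positivity)
          exact mul_le_of_le_one_left hCk (by linarith)
        have t5 : (KA + 1) * s * Y k = (KA + 1) * s * Λ * (lam k * C k)
            + (KA + 1) * s * Λ * (lam k * D k) + (KA + 1) * s * R k := by
          simp only [hY]
          ring
        linarith
      have e2 := mul_le_mul_of_nonneg_left e1 (show 0 ≤ H * (lam k * L) by positivity)
      have e3 := mul_le_mul_of_nonneg_right K5
        (show 0 ≤ lam k * (C k + lam k * D k) by positivity)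
      have e4 := mul_le_mul_of_nonneg_right K6 (show 0 ≤ lam k * R k by positivity)
      have e5 := mul_le_mul_of_nonneg_right K7 (show 0 ≤ lam k - lam (k + 1) by linarith)
      have e6 := mul_le_mul_of_nonneg_right K8
        (mul_nonneg (show 0 ≤ lam k - lam (k + 1) by linarith) hCD)
      linarith)
  rw [tendsto_iff_norm_sub_tendsto_zero]
  refine squeeze_zero (fun _ => norm_nonneg _) (fun k => hxz k i) ?_
  simpa using hlim.2.add hlim.1

lemma exists_pos_of_alphaMax_pos {n : ℕ} {α : Fin n → ℝ} (h : 0 < alphaMax α) : ∃ i, 0 < α i := by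
  by_contra! hα
  exact h.not_ge (Real.iSup_nonpos hα)

end WeightedGT

end

theorem theorem1 {n p : ℕ} [NeZero n]
    (f : Fin n → WeightedGT.Vec p → ℝ) (L μ : ℝ) (hL : 0 < L) (hμ : 0 < μ)
    (hsmooth : WeightedGT.SmoothObjectives f L)
    (hconvex : WeightedGT.StronglyConvexObjectives f μ)
    (G : Digraph (Fin n)) (hG : WeightedGT.StronglyConnected G)
    (A B : ℕ → Matrix (Fin n) (Fin n) ℝ)
    (hA : WeightedGT.RowStochasticCompatible G A)
    (hB : WeightedGT.ColStochasticCompatible G B)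
    (lam : ℕ → ℝ) (hlam : WeightedGT.DecayingWeights lam) :
    -- the objects in which the step-size bound is written exist
    (∃ φ : ℕ → Fin n → ℝ, WeightedGT.IsAbsoluteProbabilitySequence A φ ∧
      ∃ (NA NB : Seminorm ℝ (Fin n → ℝ)) (δAB δB2 : ℝ),
        WeightedGT.AdmissibleNorms A B φ NA NB δAB δB2) ∧
    -- there is a unique minimizer, and it is the limit of the iterates of every agent
    ∃ xstar : WeightedGT.Vec p,
      (∀ z, ∑ i, f i xstar ≤ ∑ i, f i z) ∧
      (∀ w, (∀ z, ∑ i, f i w ≤ ∑ i, f i z) → w = xstar) ∧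
      ∀ (φ : ℕ → Fin n → ℝ) (NA NB : Seminorm ℝ (Fin n → ℝ)) (δAB δB2 : ℝ),
        WeightedGT.IsAbsoluteProbabilitySequence A φ →
        WeightedGT.AdmissibleNorms A B φ NA NB δAB δB2 →
        ∀ α : Fin n → ℝ, (∀ i, 0 ≤ α i) →
        ∀ k₀ : ℕ, 1 ≤ k₀ →
        WeightedGT.StepSizeBound L μ A B lam α φ NA NB δAB δB2 k₀ →
        ∀ x y : ℕ → Fin n → WeightedGT.Vec p,
          WeightedGT.IsTrajectory f A B α lam x y →
          ∀ i, Filter.Tendsto (fun k => x k i) Filter.atTop (nhds xstar) := by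
  obtain ⟨xstar, hgrad, hmin, huniq⟩ :=
    WeightedGT.exists_unique_minimizer hμ hsmooth hconvex
  obtain ⟨a, -, hQA⟩ := hA.exists_uniformlyCompatible
  obtain ⟨φ, hφ⟩ := WeightedGT.exists_isAbsoluteProbabilitySequence hQA.mem
  refine ⟨⟨φ, hφ, WeightedGT.exists_admissibleNorms hG hA hB hφ⟩, xstar, hmin, huniq, ?_⟩
  intro φ NA NB δAB δB2 hφ _ α hα k₀ _ hstep x y hxy i
  obtain ⟨i₀, hi₀⟩ := WeightedGT.exists_pos_of_alphaMax_pos hstep.1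
  exact hxy.tendsto hL hμ hsmooth hconvex hG hA hB hlam hφ hα hi₀ hgrad i
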